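/- Poisson topic model. There are finitely many topics $\tau\in\{1,\dots,T\}$ and $d$ words. A document has a label $y\in\{0,1\}$ with a Bernoulli law; given $y$, a topic $\tau\sim\rho_y$; given $\tau$, independent word counts $x_j\sim\mathrm{Poisson}(\lambda^{(\tau)}_j)$, $j=1,\dots,d$, with $\lambda_j^{(\tau)}\in[0,\infty)$. Let $\lambda=\min_\tau\sum_j\lambda_j^{(\tau)}$ and assume $\lambda>0$. Fix $\delta\in(0,1)$; binomial dropout replaces $x$ by $\tilde x$, whose coordinates are, given $x$, independent with $\tilde x_j\sim\mathrm{Binom}(x_j,1-\delta)$. A weight vector $w\in\mathbb R^d$ gives the linear classifier $h_w(x)=\mathbf 1\{w\cdot x>0\}$. Put $\mathrm{Err}(h)=\mathbb P[y\ne h(x)]$ and $\mathrm{Err}_\delta(h)=\mathbb P[y\neq h(\tilde x)]$. Fix constants $\kappa,p_{\min},\alpha>0$ and $K$, and assume the following. 1. Call $w$ well-balanced if for every topic $\tau$ we have $\sum_j\lambda_j^{(\tau)}w_j^2>0$ and $\max_j w_j^2\,\sum_j\lambda^{(\tau)}_j\big/\sum_j\lambda^{(\tau)}_jw_j^2\le\kappa$.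 Let $h^*_\delta$ be a minimizer of $\mathrm{Err}_\delta$ over the well-balanced linear classifiers (assumed to exist). Given an i.i.d. sample $(x^{(i)},y^{(i)})$, $i=1,\dots,n$, $n\ge1$, from the model, let $\hat h_\delta$ be any minimizer, over the well-balanced linear classifiers $h_w$, of the dropout training loss $\sum_{i=1}^n\mathbb E\big[\mathbf 1\{h_w(\tilde x^{(i)})\ne y^{(i)}\}\,\big|\,x^{(i)},y^{(i)}\big]$. 2. For every topic $\tau$ and every label $c$, $\mathbb P[\tau]\ge p_{\min}$ and $\big|\mathbb P[y=c\mid\tau]-\tfrac12\big|\ge\alpha$. 3. With $c_\tau$ the more likely label given $\tau$ and $\mathrm{Err}_{\min}=\mathbb P[y\ne c_\tau]$, $\ |\mathrm{Err}_\delta(h^*_\delta)-\mathrm{Err}_{\min}|\le K/\sqrt\lambda$. Then $$\mathrm{Err}(\hat h_\delta)-\mathrm{Err}(h^*_\delta)=O_P\left(\sqrt{\Big(\frac dn+\frac1{\lambda^{1-\delta}}\Big)\max\Big\{1,\log\frac nd\Big\}^{1+\delta}}^{\;\frac1{1-\delta}}\right),$$ with constants that depend only on $\delta,\kappa,p_{\min},\alpha,K$.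 That is, for every $\varepsilon>0$ there is a constant $C$, depending only on $\varepsilon,\delta,\kappa,p_{\min},\alpha,K$, such that for all $d,T,n$ and all models as above, with probability at least $1-\varepsilon$ the quantity $|\mathrm{Err}(\hat h_\delta)-\mathrm{Err}(h^*_\delta)|$ is at most $C$ times the expression inside $O_P(\cdot)$. Up to a factor that is a power of $\max\{1,\log(n/d)\}$ and a constant depending on $\delta$, that expression is $(\sqrt{d/n})^{1/(1-\delta)}+1/\sqrt\lambda$. -/

import Mathlib

open MeasureTheory ProbabilityTheory
open scoped NNReal ENNReal

noncomputable section

namespace DropoutTopic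

/-- A labelled document: its label (`true` is class 1, `false` is class 0), its (latent) topic,
and its vector of word counts. -/
abbrev Example (d T : ℕ) := Bool × Fin T × (Fin d → ℕ)

/-- The label of a document. -/
abbrev label {d T : ℕ} (z : Example d T) : Bool := z.1

/-- The latent topic of a document. -/
abbrev topic {d T : ℕ} (z : Example d T) : Fin T := z.2.1

/-- The word counts of a document. -/
abbrev counts {d T : ℕ} (z : Example d T) : Fin d → ℕ := z.2.2

/-- The parameters of a Poisson topic model with `d` words and `T` topics: the Bernoulli law of
the label, the topic distribution `ρ_y` of each class, and the mean counts `λ_j^{(τ)} ∈ [0, ∞)`. -/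
structure PoissonTopicModel (d T : ℕ) where
  labelLaw : PMF Bool
  topicLaw : Bool → PMF (Fin T)
  rate : Fin T → Fin d → ℝ≥0

/-- The linear classifier `𝟙{w · x > 0}`. -/
def predict {d : ℕ} (w : Fin d → ℝ) (x : Fin d → ℕ) : Bool :=
  decide (0 < ∑ j, w j * (x j : ℝ))

/-- The zero-one loss of the linear classifier with weights `w` on the document `x` with
label `y`. -/
def zeroOneLoss {d : ℕ} (w : Fin d → ℝ) (x : Fin d → ℕ) (y : Bool) : ℝ :=
  if predict w x = y then 0 else 1

/-- Binomial dropout: the law of `x̃` given `x`, with independent coordinates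
`x̃_j ∼ Binom(x_j, 1 - δ)`. -/
def thin {d : ℕ} (δ : unitInterval) (x : Fin d → ℕ) : Measure (Fin d → ℕ) :=
  Measure.pi fun j => binomial (x j) (unitInterval.symm δ)

/-- The error rate `ℙ[y ≠ h(x)]` of the linear classifier with weights `w` when the document is
drawn from `μ`. -/
def errorRate {d T : ℕ} (μ : Measure (Example d T)) (w : Fin d → ℝ) : ℝ :=
  μ.real {z | label z ≠ predict w (counts z)}

namespace PoissonTopicModel

variable {d T : ℕ} (M : PoissonTopicModel d T)

/-- The joint law of label and topic: draw the label `y`, then the topic from `ρ_y`. -/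
def latentLaw : PMF (Bool × Fin T) :=
  M.labelLaw.bind fun y => (M.topicLaw y).map fun τ => (y, τ)

/-- The data-generating measure: draw label and topic `(y, τ)`, then independent word counts
`x_j ∼ Poisson(λ_j^{(τ)})`. -/
def law : Measure (Example d T) :=
  M.latentLaw.toMeasure.bind fun p =>
    (Measure.pi fun j => poissonMeasure (M.rate p.2 j)).map fun x => (p.1, p.2, x)

/-- The dropout measure: draw a document from the data-generating measure, then thin its word
counts by binomial dropout. -/
def dropoutLaw (δ : unitInterval) : Measure (Example d T) :=
  M.law.bind fun z => (thin δ (counts z)).map fun x => (label z, topic z, x)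

/-- `Err`, the error rate under the data-generating measure. -/
def err (w : Fin d → ℝ) : ℝ := errorRate M.law w

/-- `Err_δ`, the error rate under the dropout measure. -/
def errDropout (δ : unitInterval) (w : Fin d → ℝ) : ℝ := errorRate (M.dropoutLaw δ) w

/-- The average length `‖λ^{(τ)}‖₁` of a document with topic `τ`. -/
def meanLength (τ : Fin T) : ℝ := ∑ j, (M.rate τ j : ℝ)

/-- `λ`, the shortest average document length across topics. -/
def minLength : ℝ := ⨅ τ, M.meanLength τ

/-- The probability `ℙ[τ]` of observing the topic `τ`. -/
def topicProb (τ : Fin T) : ℝ := M.law.real {z | topic z = τ}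

/-- The conditional probability `ℙ[y = c | τ]` of the label `c` given the topic `τ`. -/
def labelProb (c : Bool) (τ : Fin T) : ℝ :=
  (cond M.law {z | topic z = τ}).real {z | label z = c}

/-- `c_τ`, the more likely label given the topic `τ`. -/
def bestLabel (τ : Fin T) : Bool := decide (M.labelProb false τ < M.labelProb true τ)

/-- `Err_min = ℙ[y ≠ c_τ]`, the error rate of the optimal rule that sees the topic. -/
def errMin : ℝ := M.law.real {z | label z ≠ M.bestLabel (topic z)}

/-- The weights `w` are well-balanced with constant `κ`: for each topic `τ`,
`max_j w_j² · ∑_j λ_j^{(τ)} / ∑_j λ_j^{(τ)} w_j²` is well defined and at most `κ`. -/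
def WellBalanced (κ : ℝ) (w : Fin d → ℝ) : Prop :=
  ∀ τ, 0 < ∑ j, (M.rate τ j : ℝ) * w j ^ 2 ∧
    (⨆ j, w j ^ 2) * M.meanLength τ / (∑ j, (M.rate τ j : ℝ) * w j ^ 2) ≤ κ

/-- `w` are the weights of an expected risk minimizer `h*_δ` for the dropout measure among the
well-balanced linear classifiers. -/
def IsDropoutMinimizer (κ : ℝ) (δ : unitInterval) (w : Fin d → ℝ) : Prop :=
  M.WellBalanced κ w ∧ ∀ v, M.WellBalanced κ v → M.errDropout δ w ≤ M.errDropout δ v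

/-- The dropout training loss `∑_i 𝔼[ℓ(w; x̃^{(i)}, y^{(i)})]` for the zero-one loss; the
expectation is over the dropout noise only. -/
def dropoutTrainLoss {n : ℕ} (δ : unitInterval) (z : Fin n → Example d T) (w : Fin d → ℝ) : ℝ :=
  ∑ i, ∫ x, zeroOneLoss w x (label (z i)) ∂(thin δ (counts (z i)))

/-- `w` are the weights of a dropout empirical risk minimizer `ĥ_δ` for the training sample `z`
among the well-balanced linear classifiers. -/
def IsDropoutERM {n : ℕ} (κ : ℝ) (δ : unitInterval) (z : Fin n → Example d T)
    (w : Fin d → ℝ) : Prop :=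
  M.WellBalanced κ w ∧
    ∀ v, M.WellBalanced κ v → dropoutTrainLoss δ z w ≤ dropoutTrainLoss δ z v

end PoissonTopicModel

/-- The rate
`√((d/n + 1/λ^{1-δ}) · max{1, log(n/d)}^{1+δ})^{1/(1-δ)}`. -/
def excessRate (d n : ℕ) (lam δ : ℝ) : ℝ :=
  Real.sqrt (((d : ℝ) / n + 1 / lam ^ (1 - δ)) *
    max 1 (Real.log ((n : ℝ) / d)) ^ (1 + δ)) ^ (1 / (1 - δ))

end DropoutTopic

end

/-! Binomial thinning turns a Poisson vector with rates `λ_j` into one with rates `(1 - δ) λ_j`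
(`poissonVec_bind_thin`), so the dropout law is again a topic model, with shorter documents. Given
the topic, `w · x` is a sum of independent Poisson terms. Well-balancedness bounds each jump,
relative to the standard deviation, by `√(κ/λ)`, and a Berry–Esseen bound proved by Stein's method
(`abs_measureReal_centredSum_le_sub`) gives a miss probability `Φ(-u) + O(1/√λ)`. Here `u` is the
signed standardised mean. Thinning multiplies it by `√(1-δ)` (`zScore_mul`), so the miss probability
under dropout is `Φ(-√(1-δ) u) + O(1/√λ)`. By Gaussian tail estimates `Φ(-u)^(1-δ)` is at most
`Φ(-√(1-δ) u)` up to a factor of order `u^δ`. Hence a miss probability `η` under dropout forces one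
of order `η^(1/(1-δ))` on full documents, up to logarithms (`exists_tail_transfer`); this is the
gain from dropout.

It remains to bound `η`. The risk above `Err_min` is a sum over topics of (label margin) × (miss
probability) (`err_sub_errMin`); since topics are neither rare nor ambiguous, the excess dropout
risk controls the dropout miss probability of every topic. For `h*_δ` this excess is at most `K/√λ`.
For `ĥ_δ` one adds twice the uniform deviation of the dropout training loss, of order `√((d/n)
log(n/d))` by symmetrisation and the VC bound for half-spaces
(`measure_exists_lt_abs_dropoutTrainLoss_sub_le`). Both classifiers then have true risk within the
claimed rate above `Err_min`, hence within that rate of each other. -/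

namespace DropoutTopic

/-! ### Gaussian tail estimates. -/

/-- The unnormalised Gaussian distribution function `∫_{-∞}^x e^{-t²/2} dt`. -/
noncomputable def gaussInt (x : ℝ) : ℝ := ∫ t in Set.Iic x, Real.exp (-t ^ 2 / 2)

/-- The total Gaussian mass `∫ e^{-t²/2} dt`. -/
noncomputable def gaussTotal : ℝ := ∫ t : ℝ, Real.exp (-t ^ 2 / 2)

lemma integrable_gauss : Integrable fun t : ℝ => Real.exp (-t ^ 2 / 2) := by
  have := integrable_exp_neg_mul_sq (b := 1 / 2) (by norm_num)
  refine this.congr (ae_of_all _ fun t => ?_)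
  simp only
  congr 1
  ring

lemma hasDerivAt_gaussInt (x : ℝ) : HasDerivAt gaussInt (Real.exp (-x ^ 2 / 2)) x := by
  have hc : Continuous fun t : ℝ => Real.exp (-t ^ 2 / 2) := by fun_prop
  have h : gaussInt = fun x => gaussInt 0 + ∫ t in (0 : ℝ)..x, Real.exp (-t ^ 2 / 2) := by
    funext y
    rw [← intervalIntegral.integral_Iic_sub_Iic integrable_gauss.integrableOn
      integrable_gauss.integrableOn]
    simp [gaussInt]
  rw [h]
  exact (intervalIntegral.integral_hasDerivAt_right (hc.intervalIntegrable _ _)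
    hc.aestronglyMeasurable.stronglyMeasurableAtFilter hc.continuousAt).const_add _

lemma gaussInt_neg (x : ℝ) : gaussInt (-x) = ∫ t in Set.Ioi x, Real.exp (-t ^ 2 / 2) := by
  have := integral_comp_neg_Ioi x (fun t : ℝ => Real.exp (-t ^ 2 / 2))
  simp only [neg_sq] at this
  rw [this, gaussInt]

lemma gaussInt_add_neg (x : ℝ) : gaussInt x + gaussInt (-x) = gaussTotal := by
  rw [gaussInt_neg, gaussInt, ← Set.compl_Iic, integral_add_compl measurableSet_Iic
    integrable_gauss, gaussTotal]

lemma gaussInt_pos (x : ℝ) : 0 < gaussInt x := by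
  rw [gaussInt, setIntegral_pos_iff_support_of_nonneg_ae (ae_of_all _ fun t => (Real.exp_pos _).le)
    integrable_gauss.integrableOn]
  have : (Function.support fun t : ℝ => Real.exp (-t ^ 2 / 2)) = Set.univ := by
    ext t; simp [(Real.exp_pos _).ne']
  rw [this, Set.univ_inter]
  simp

lemma gaussTotal_pos : 0 < gaussTotal := by
  rw [← gaussInt_add_neg 0]
  have := gaussInt_pos 0
  have := gaussInt_pos (-0)
  linarith

lemma gaussInt_le_total (x : ℝ) : gaussInt x ≤ gaussTotal := by
  rw [← gaussInt_add_neg x]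
  linarith [gaussInt_pos (-x)]

lemma gaussInt_mono : Monotone gaussInt :=
  monotone_of_hasDerivAt_nonneg hasDerivAt_gaussInt fun _ => (Real.exp_pos _).le

/-- On `t > x` the constant `x` is at most `t`, and `t e^{-t²/2}` has the explicit primitive
`-e^{-t²/2}`. -/
lemma mul_gaussInt_neg_le {x : ℝ} (hx : 0 < x) : x * gaussInt (-x) ≤ Real.exp (-x ^ 2 / 2) := by
  have hd : ∀ t ∈ Set.Ici x, HasDerivAt (fun t : ℝ => -Real.exp (-t ^ 2 / 2))
      (t * Real.exp (-t ^ 2 / 2)) t := by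
    intro t _
    have h1 : HasDerivAt (fun t : ℝ => -t ^ 2 / 2) (-t) t := by
      refine ((hasDerivAt_pow 2 t).neg.div_const 2).congr_deriv ?_
      simp
      ring
    exact h1.exp.neg.congr_deriv (by ring)
  have hlim : Filter.Tendsto (fun t : ℝ => -Real.exp (-t ^ 2 / 2)) Filter.atTop (nhds 0) := by
    rw [← neg_zero]
    refine Filter.Tendsto.neg (Real.tendsto_exp_atBot.comp ?_)
    have : Filter.Tendsto (fun t : ℝ => -(t ^ 2 / 2)) Filter.atTop Filter.atBot :=
      Filter.tendsto_neg_atTop_atBot.comp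
        ((Filter.tendsto_pow_atTop two_ne_zero).atTop_div_const two_pos)
    simpa [neg_div] using this
  have hpos : ∀ t ∈ Set.Ioi x, 0 ≤ t * Real.exp (-t ^ 2 / 2) := fun t ht =>
    mul_nonneg (hx.le.trans (le_of_lt ht)) (Real.exp_pos _).le
  have hint := integrableOn_Ioi_deriv_of_nonneg' hd hpos hlim
  have hval := integral_Ioi_of_hasDerivAt_of_nonneg' hd hpos hlim
  rw [gaussInt_neg, ← integral_const_mul]
  calc _ ≤ ∫ t in Set.Ioi x, t * Real.exp (-t ^ 2 / 2) := by
        refine setIntegral_mono_on (integrable_gauss.integrableOn.const_mul x) hint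
          measurableSet_Ioi fun t ht => ?_
        exact mul_le_mul_of_nonneg_right (le_of_lt ht) (Real.exp_pos _).le
    _ = _ := by rw [hval]; ring

/-- A rectangle of width `r` under the decreasing density. The tail transfer takes `r = 1/u`, which
gives the correct order of the tail. -/
lemma mul_exp_le_gaussInt_neg {x r : ℝ} (hx : 0 ≤ x) (hr : 0 ≤ r) :
    r * Real.exp (-(x + r) ^ 2 / 2) ≤ gaussInt (-x) := by
  rw [gaussInt_neg]
  calc r * Real.exp (-(x + r) ^ 2 / 2)
      = ∫ t in Set.Ioc x (x + r), Real.exp (-(x + r) ^ 2 / 2) := by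
        simp [hr]
    _ ≤ ∫ t in Set.Ioc x (x + r), Real.exp (-t ^ 2 / 2) := by
        refine setIntegral_mono_on (by simp) integrable_gauss.integrableOn
          measurableSet_Ioc fun t ht => Real.exp_le_exp.2 ?_
        have : t ^ 2 ≤ (x + r) ^ 2 := by
          apply pow_le_pow_left₀ (hx.trans ht.1.le) ht.2
        linarith
    _ ≤ _ := by
        refine setIntegral_mono_set integrable_gauss.integrableOn
          (ae_of_all _ fun t => (Real.exp_pos _).le) (ae_of_all _ fun t ht => ht.1)

/-- A bound for `e^{x²/2} ∫_x^∞ e^{-t²/2} dt` on the positive half-line. -/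
noncomputable def millsConst : ℝ := gaussTotal * Real.exp 1 + 1

lemma millsConst_pos : 0 < millsConst := by
  have := gaussTotal_pos
  unfold millsConst
  positivity

lemma gaussInt_neg_le {x : ℝ} (hx : 0 ≤ x) :
    gaussInt (-x) ≤ millsConst * Real.exp (-x ^ 2 / 2) := by
  have hN := gaussTotal_pos
  have he := Real.exp_pos (-x ^ 2 / 2)
  rcases le_or_gt x 1 with h | h
  · have h1 : 1 ≤ Real.exp 1 * Real.exp (-x ^ 2 / 2) := by
      rw [← Real.exp_add]
      exact Real.one_le_exp (by nlinarith)
    calc gaussInt (-x) ≤ gaussTotal * 1 := by rw [mul_one]; exact gaussInt_le_total _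
      _ ≤ gaussTotal * (Real.exp 1 * Real.exp (-x ^ 2 / 2)) := by gcongr
      _ ≤ _ := by unfold millsConst; nlinarith
  · have h1 := mul_gaussInt_neg_le (x := x) (by linarith)
    have h2 := gaussInt_pos (-x)
    calc gaussInt (-x) ≤ x * gaussInt (-x) := by nlinarith
      _ ≤ Real.exp (-x ^ 2 / 2) := h1
      _ ≤ _ := by
        unfold millsConst
        have : 0 ≤ gaussTotal * Real.exp 1 * Real.exp (-x ^ 2 / 2) := by positivity
        linarith

lemma exp_mul_gaussInt_le {w : ℝ} (hw : w ≤ 0) :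
    Real.exp (w ^ 2 / 2) * gaussInt w ≤ millsConst := by
  have h := gaussInt_neg_le (x := -w) (by linarith)
  rw [neg_neg, neg_sq] at h
  calc _ ≤ Real.exp (w ^ 2 / 2) * (millsConst * Real.exp (-w ^ 2 / 2)) := by gcongr
    _ = millsConst * (Real.exp (w ^ 2 / 2) * Real.exp (-w ^ 2 / 2)) := by ring
    _ = millsConst := by
      rw [← Real.exp_add, show w ^ 2 / 2 + -w ^ 2 / 2 = 0 by ring, Real.exp_zero, mul_one]

lemma abs_mul_exp_mul_gaussInt_le {w : ℝ} (hw : w ≤ 0) :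
    |w| * (Real.exp (w ^ 2 / 2) * gaussInt w) ≤ 1 := by
  rcases hw.lt_or_eq with h | rfl
  · have h1 := mul_gaussInt_neg_le (x := -w) (by linarith)
    rw [neg_neg, neg_sq] at h1
    rw [abs_of_neg h]
    calc _ = Real.exp (w ^ 2 / 2) * (-w * gaussInt w) := by ring
      _ ≤ Real.exp (w ^ 2 / 2) * Real.exp (-w ^ 2 / 2) := by gcongr
      _ = 1 := by
        rw [← Real.exp_add, show w ^ 2 / 2 + -w ^ 2 / 2 = 0 by ring, Real.exp_zero]
  · simp

/-! ### The solution of Stein's equation and its regularity. -/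

/-- The lower branch of the solution of Stein's equation at level `x`. -/
noncomputable def steinLower (x w : ℝ) : ℝ :=
  Real.exp (w ^ 2 / 2) * gaussInt w * (gaussInt (-x) / gaussTotal)

lemma steinLower_nonneg (x w : ℝ) : 0 ≤ steinLower x w := by
  have := gaussInt_pos w
  have := gaussInt_pos (-x)
  have := gaussTotal_pos
  unfold steinLower
  positivity

lemma steinLower_le_exp_mul {x w : ℝ} :
    steinLower x w ≤ Real.exp (w ^ 2 / 2) * gaussInt w := by
  have h1 : gaussInt (-x) / gaussTotal ≤ 1 :=
    (div_le_one gaussTotal_pos).2 (gaussInt_le_total _)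
  have := gaussInt_pos w
  unfold steinLower
  exact mul_le_of_le_one_right (by positivity) h1

/-- For `w ≥ 0` the growth of `e^{w²/2}` has to be absorbed by the tail beyond `x`, which is at most
the tail beyond `w`. This reduces the bounds to those for nonpositive arguments. -/
lemma steinLower_le_of_le {x w : ℝ} (hw : w ≤ x) :
    steinLower x w ≤ Real.exp ((-w) ^ 2 / 2) * gaussInt (-w) := by
  have h1 : gaussInt w / gaussTotal ≤ 1 :=
    (div_le_one gaussTotal_pos).2 (gaussInt_le_total _)
  have h2 : gaussInt (-x) ≤ gaussInt (-w) := gaussInt_mono (by linarith)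
  have := gaussInt_pos w
  have := gaussInt_pos (-w)
  have := gaussTotal_pos
  calc steinLower x w = Real.exp (w ^ 2 / 2) * gaussInt (-x) * (gaussInt w / gaussTotal) := by
        unfold steinLower; ring
    _ ≤ Real.exp (w ^ 2 / 2) * gaussInt (-w) * 1 := by gcongr
    _ = _ := by rw [neg_sq, mul_one]

lemma steinLower_le {x w : ℝ} (hw : w ≤ x) : steinLower x w ≤ millsConst := by
  rcases le_total w 0 with h | h
  · exact steinLower_le_exp_mul.trans (exp_mul_gaussInt_le h)
  · exact (steinLower_le_of_le hw).trans (exp_mul_gaussInt_le (by linarith))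

lemma abs_mul_steinLower_le {x w : ℝ} (hw : w ≤ x) : |w * steinLower x w| ≤ 1 := by
  rw [abs_mul, abs_of_nonneg (steinLower_nonneg x w)]
  rcases le_total w 0 with h | h
  · exact (mul_le_mul_of_nonneg_left steinLower_le_exp_mul (abs_nonneg _)).trans
      (abs_mul_exp_mul_gaussInt_le h)
  · refine (mul_le_mul_of_nonneg_left (steinLower_le_of_le hw) (abs_nonneg _)).trans ?_
    rw [← abs_neg w]
    exact abs_mul_exp_mul_gaussInt_le (by linarith)

lemma hasDerivAt_steinLower (x w : ℝ) :
    HasDerivAt (steinLower x) (w * steinLower x w + gaussInt (-x) / gaussTotal) w := by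
  have h1 : HasDerivAt (fun w : ℝ => w ^ 2 / 2) w w := by
    refine ((hasDerivAt_pow 2 w).div_const 2).congr_deriv ?_
    simp
  refine ((h1.exp.mul (hasDerivAt_gaussInt w)).mul_const
    (gaussInt (-x) / gaussTotal)).congr_deriv ?_
  rw [← Real.exp_add, show w ^ 2 / 2 + -w ^ 2 / 2 = 0 by ring, Real.exp_zero]
  unfold steinLower
  ring

lemma steinLower_lipschitz {x u v : ℝ} (hu : u ≤ x) (hv : v ≤ x) :
    |steinLower x u - steinLower x v| ≤ 2 * |u - v| := by
  have h := (convex_Iic x).norm_image_sub_le_of_norm_hasDerivWithin_le (f := steinLower x)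
    (C := 2) (fun w _ => (hasDerivAt_steinLower x w).hasDerivWithinAt) (fun w hw => ?_) hv hu
  · simpa using h
  · have h1 := abs_mul_steinLower_le hw
    have h2 : gaussInt (-x) / gaussTotal ≤ 1 :=
      (div_le_one gaussTotal_pos).2 (gaussInt_le_total _)
    have h3 : 0 ≤ gaussInt (-x) / gaussTotal :=
      div_nonneg (gaussInt_pos _).le gaussTotal_pos.le
    rw [Real.norm_eq_abs]
    rw [abs_le] at h1 ⊢
    constructor <;> linarith

/-- The derivative is `w f(w)` plus a constant, so its increment is `u (f(w) - f(u)) + (w - u)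
f(w)`. The Lipschitz and sup bounds for `f` control the two terms. -/
lemma steinLower_taylor {x u v : ℝ} (hu : u ≤ x) (hv : v ≤ x) :
    |steinLower x v - steinLower x u
      - (v - u) * (u * steinLower x u + gaussInt (-x) / gaussTotal)| ≤
    (v - u) ^ 2 * (2 * |u| + millsConst) := by
  set c := gaussInt (-x) / gaussTotal
  set g := u * steinLower x u + c
  have hconv : Convex ℝ (Set.uIcc u v) := convex_uIcc u v
  have h := hconv.norm_image_sub_le_of_norm_hasDerivWithin_le
    (f := fun w => steinLower x w - w * g) (f' := fun w => w * steinLower x w + c - g)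
    (C := |v - u| * (2 * |u| + millsConst)) (fun w _ => ?_) (fun w hw => ?_)
    Set.left_mem_uIcc Set.right_mem_uIcc
  · simp only [Real.norm_eq_abs] at h
    calc _ = |steinLower x v - v * g - (steinLower x u - u * g)| := by congr 1; ring
      _ ≤ _ := h
      _ = _ := by rw [← sq_abs (v - u)]; ring
  · exact (((hasDerivAt_steinLower x w).sub
      ((hasDerivAt_id w).mul_const g)).congr_deriv (by simp [c])).hasDerivWithinAt
  · have hwx : w ≤ x := by
      rw [Set.mem_uIcc] at hw
      rcases hw with hw | hw <;> linarith
    have hwu : |w - u| ≤ |v - u| := by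
      exact Set.abs_sub_left_of_mem_uIcc hw
    rw [Real.norm_eq_abs]
    have e : w * steinLower x w + c - g
        = u * (steinLower x w - steinLower x u) + (w - u) * steinLower x w := by
      simp only [g]; ring
    rw [e]
    calc _ ≤ |u| * |steinLower x w - steinLower x u| + |w - u| * |steinLower x w| := by
          rw [← abs_mul, ← abs_mul]; exact abs_add_le _ _
      _ ≤ |u| * (2 * |v - u|) + |v - u| * millsConst := by
          have h1 := steinLower_lipschitz hwx hu
          have h2 : |steinLower x w| ≤ millsConst := by
            rw [abs_of_nonneg (steinLower_nonneg _ _)]; exact steinLower_le hwx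
          have h3 := steinLower_nonneg x w
          gcongr
          linarith
      _ = _ := by ring

/-- The bounded solution of Stein's equation `f' w - w f w = 𝟙{w ≤ x} - Φ x`. -/
noncomputable def steinSol (x w : ℝ) : ℝ :=
  if w ≤ x then steinLower x w else steinLower (-x) (-w)

lemma steinSol_of_le {x w : ℝ} (h : w ≤ x) : steinSol x w = steinLower x w := if_pos h

/-- The two branches agree at `w = x`, so either formula may be used there; this continuity glues
the Lipschitz bounds together. -/
lemma steinSol_of_ge {x w : ℝ} (h : x ≤ w) : steinSol x w = steinLower (-x) (-w) := by
  rcases h.lt_or_eq with h | rfl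
  · exact if_neg (not_le.2 h)
  · rw [steinSol_of_le le_rfl]
    simp [steinLower]
    ring

lemma steinSol_nonneg (x w : ℝ) : 0 ≤ steinSol x w := by
  unfold steinSol
  split_ifs <;> exact steinLower_nonneg _ _

lemma steinSol_le (x w : ℝ) : steinSol x w ≤ millsConst := by
  rcases le_total w x with h | h
  · rw [steinSol_of_le h]; exact steinLower_le h
  · rw [steinSol_of_ge h]; exact steinLower_le (by linarith)

lemma abs_mul_steinSol_le (x w : ℝ) : |w * steinSol x w| ≤ 1 := by
  rcases le_total w x with h | h
  · rw [steinSol_of_le h]; exact abs_mul_steinLower_le h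
  · rw [steinSol_of_ge h]
    have := abs_mul_steinLower_le (x := -x) (w := -w) (by linarith)
    rwa [neg_mul, abs_neg] at this

/-- The derivative of `steinSol`, read off Stein's equation. -/
noncomputable def steinDeriv (x w : ℝ) : ℝ :=
  w * steinSol x w + (if w ≤ x then 1 else 0) - gaussInt x / gaussTotal

lemma gaussInt_div_add (x : ℝ) : gaussInt x / gaussTotal + gaussInt (-x) / gaussTotal = 1 := by
  rw [← add_div, gaussInt_add_neg, div_self gaussTotal_pos.ne']

lemma abs_steinDeriv_le (x w : ℝ) : |steinDeriv x w| ≤ 2 := by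
  have h1 := abs_mul_steinSol_le x w
  have h2 := gaussInt_div_add x
  have h3 : 0 ≤ gaussInt (-x) / gaussTotal := div_nonneg (gaussInt_pos _).le gaussTotal_pos.le
  have h4 : 0 ≤ gaussInt x / gaussTotal := div_nonneg (gaussInt_pos _).le gaussTotal_pos.le
  unfold steinDeriv
  rw [abs_le] at h1 ⊢
  split_ifs <;> constructor <;> linarith

lemma steinSol_lipschitz (x u v : ℝ) : |steinSol x u - steinSol x v| ≤ 2 * |u - v| := by
  have key : ∀ u v, u ≤ x → x ≤ v → |steinSol x u - steinSol x v| ≤ 2 * |u - v| := by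
    intro u v hu hv
    have h1 := steinLower_lipschitz hu (le_refl x)
    have h2 := steinLower_lipschitz (x := -x) (u := -x) (v := -v) le_rfl (by linarith)
    rw [← steinSol_of_le hu, ← steinSol_of_le (le_refl x)] at h1
    rw [← steinSol_of_ge hv, ← steinSol_of_ge (le_refl x)] at h2
    rw [abs_of_nonpos (by linarith : u - x ≤ 0)] at h1
    rw [abs_of_nonneg (by linarith : 0 ≤ -x - -v)] at h2
    rw [abs_of_nonpos (by linarith : u - v ≤ 0)]
    rw [abs_le] at *
    constructor <;> linarith
  rcases le_total u x with hu | hu <;> rcases le_total v x with hv | hv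
  · rw [steinSol_of_le hu, steinSol_of_le hv]; exact steinLower_lipschitz hu hv
  · exact key u v hu hv
  · rw [abs_sub_comm, abs_sub_comm u v]; exact key v u hv hu
  · rw [steinSol_of_ge hu, steinSol_of_ge hv]
    refine (steinLower_lipschitz (by linarith) (by linarith)).trans ?_
    rw [abs_sub_comm u v, neg_sub_neg]

/-- The derivative jumps only at `x`. A step `a` that cannot reach `x` stays on one branch and has a
quadratic error. Otherwise `|w - x| ≤ |a|`, and the Lipschitz bound costs `2|a| + 2|a|`; the
indicator is kept because this event is rare. -/
lemma steinSol_taylor (x w a : ℝ) :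
    |steinSol x (w + a) - steinSol x w - a * steinDeriv x w| ≤
      a ^ 2 * (2 * |w| + millsConst) + 4 * |a| * (if |w - x| ≤ |a| then 1 else 0) := by
  have hpos : 0 ≤ a ^ 2 * (2 * |w| + millsConst) := by
    have := millsConst_pos; positivity
  by_cases hnear : |w - x| ≤ |a|
  · rw [if_pos hnear, mul_one]
    have h1 := steinSol_lipschitz x (w + a) w
    have h2 := abs_steinDeriv_le x w
    rw [add_sub_cancel_left] at h1
    calc _ ≤ |steinSol x (w + a) - steinSol x w| + |a * steinDeriv x w| := abs_sub _ _
      _ ≤ 2 * |a| + |a| * 2 := by rw [abs_mul]; gcongr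
      _ ≤ _ := by linarith
  · rw [if_neg hnear, mul_zero, add_zero]
    push Not at hnear
    rcases le_or_gt w x with hw | hw
    · have hwa : w + a ≤ x := by
        rw [abs_of_nonpos (a := w - x) (by linarith)] at hnear
        have := le_abs_self a
        linarith
      have h := steinLower_taylor hw hwa
      have h2 := gaussInt_div_add x
      rw [add_sub_cancel_left] at h
      rw [steinDeriv, steinSol_of_le hw, steinSol_of_le hwa, if_pos hw]
      convert h using 4
      linarith
    · have hwa : x ≤ w + a := by
        rw [abs_of_nonneg (a := w - x) (by linarith)] at hnear
        have := neg_abs_le a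
        linarith
      have h := steinLower_taylor (x := -x) (u := -w) (v := -(w + a)) (by linarith) (by linarith)
      rw [neg_neg, abs_neg, show -(w + a) - -w = -a by ring, neg_sq] at h
      rw [steinDeriv, steinSol_of_ge hw.le, steinSol_of_ge hwa, if_neg (not_le.2 hw)]
      convert h using 2
      ring

/-! ### Stein's method for linear statistics of Poisson vectors. -/

section PoissonVector

variable {ι : Type*} [Fintype ι]

/-- The law of a vector of independent Poisson counts. -/
noncomputable def poissonVec (r : ι → ℝ≥0) : Measure (ι → ℕ) :=
  Measure.pi fun j => poissonMeasure (r j)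

instance (r : ι → ℝ≥0) : IsProbabilityMeasure (poissonVec r) := by
  unfold poissonVec; infer_instance

lemma poissonMeasure_succ (r : ℝ≥0) (n : ℕ) :
    ((n + 1 : ℕ) : ℝ≥0∞) * poissonMeasure r {n + 1} = r * poissonMeasure r {n} := by
  rw [poissonMeasure_singleton, poissonMeasure_singleton, ← ENNReal.ofReal_coe_nnreal,
    ← ENNReal.ofReal_natCast, ← ENNReal.ofReal_mul (by positivity),
    ← ENNReal.ofReal_mul (by positivity)]
  congr 1
  rw [Nat.factorial_succ, pow_succ]
  push_cast
  field_simp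

/-- Size biasing: `(n + 1) P(n + 1) = r P(n)` for a Poisson law. This is the source of Stein's
identity below. -/
lemma poissonVec_withDensity [DecidableEq ι] (r : ι → ℝ≥0) (j : ι) :
    (poissonVec r).withDensity (fun x => ((x j : ℝ≥0) : ℝ≥0∞)) =
      r j • (poissonVec r).map fun x => x + Pi.single j 1 := by
  refine Measure.ext_of_singleton fun x => ?_
  rw [withDensity_apply _ (measurableSet_singleton x), lintegral_singleton, Measure.smul_apply,
    Measure.map_apply Measurable.of_discrete (measurableSet_singleton x)]
  rcases Nat.eq_zero_or_pos (x j) with h | h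
  -- When `x j = 0` both sides vanish, since a shifted vector has a positive `j`-th entry.
  · have : (fun y : ι → ℕ => y + Pi.single j 1) ⁻¹' {x} = ∅ := by
      ext y
      simp only [Set.mem_preimage, Set.mem_singleton_iff, Set.mem_empty_iff_false, iff_false]
      rintro rfl
      simp at h
    rw [this, h]
    simp
  · obtain ⟨y, rfl⟩ : ∃ y : ι → ℕ, x = y + Pi.single j 1 := by
      refine ⟨x - Pi.single j 1, ?_⟩
      ext i
      rcases eq_or_ne i j with rfl | hi
      · simp; omega
      · simp [hi]
    have : (fun y : ι → ℕ => y + Pi.single j 1) ⁻¹' {y + Pi.single j 1} = {y} := by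
      ext z; simp
    rw [this, poissonVec, Measure.pi_singleton, Measure.pi_singleton,
      ← Finset.mul_prod_erase Finset.univ _ (Finset.mem_univ j),
      ← Finset.mul_prod_erase Finset.univ (fun i => poissonMeasure (r i) {y i})
        (Finset.mem_univ j), ENNReal.smul_def, smul_eq_mul, ← mul_assoc, ← mul_assoc]
    congr 1
    · have := poissonMeasure_succ (r j) (y j)
      simpa using this
    · refine Finset.prod_congr rfl fun i hi => ?_
      simp [Finset.ne_of_mem_erase hi]

lemma integral_coord_mul_poissonVec [DecidableEq ι] (r : ι → ℝ≥0) (j : ι) (F : (ι → ℕ) → ℝ) :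
    ∫ x, (x j : ℝ) * F x ∂(poissonVec r) =
      r j * ∫ x, F (x + Pi.single j 1) ∂(poissonVec r) := by
  have h := integral_withDensity_eq_integral_smul (μ := poissonVec r)
    (f := fun x => (x j : ℝ≥0)) Measurable.of_discrete F
  rw [poissonVec_withDensity, integral_smul_nnreal_measure,
    integral_map Measurable.of_discrete.aemeasurable
      StronglyMeasurable.of_discrete.aestronglyMeasurable] at h
  simp only [NNReal.smul_def, smul_eq_mul, NNReal.coe_natCast] at h
  exact h.symm

lemma lintegral_coord_mul_poissonVec [DecidableEq ι] (r : ι → ℝ≥0) (j : ι)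
    (F : (ι → ℕ) → ℝ≥0∞) :
    ∫⁻ x, (x j : ℝ≥0∞) * F x ∂(poissonVec r) =
      r j * ∫⁻ x, F (x + Pi.single j 1) ∂(poissonVec r) := by
  have h := lintegral_withDensity_eq_lintegral_mul (poissonVec r)
    (f := fun x => ((x j : ℝ≥0) : ℝ≥0∞)) Measurable.of_discrete
    (g := F) Measurable.of_discrete
  rw [poissonVec_withDensity, lintegral_smul_measure,
    lintegral_map Measurable.of_discrete Measurable.of_discrete, ENNReal.smul_def,
    smul_eq_mul] at h
  rw [h]
  simp

lemma integrable_coord_poissonVec (r : ι → ℝ≥0) (j : ι) :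
    Integrable (fun x => (x j : ℝ)) (poissonVec r) := by
  classical
  refine ⟨StronglyMeasurable.of_discrete.aestronglyMeasurable, ?_⟩
  have := lintegral_coord_mul_poissonVec r j fun _ => 1
  simp only [mul_one, lintegral_const, measure_univ] at this
  rw [hasFiniteIntegral_iff_enorm]
  have e : ∀ x : ι → ℕ, ‖(x j : ℝ)‖ₑ = (x j : ℝ≥0∞) := fun x => by
    rw [Real.enorm_eq_ofReal (by positivity), ENNReal.ofReal_natCast]
  simp only [e, this]
  exact ENNReal.coe_lt_top

lemma integrable_coord_mul_coord_poissonVec (r : ι → ℝ≥0) (j k : ι) :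
    Integrable (fun x => (x j : ℝ) * (x k : ℝ)) (poissonVec r) := by
  classical
  refine ⟨StronglyMeasurable.of_discrete.aestronglyMeasurable, ?_⟩
  have h := lintegral_coord_mul_poissonVec r j fun x => (x k : ℝ≥0∞)
  have h2 := lintegral_coord_mul_poissonVec r k fun _ => 1
  simp only [mul_one, lintegral_const, measure_univ] at h2
  rw [hasFiniteIntegral_iff_enorm]
  have e : ∀ x : ι → ℕ, ‖(x j : ℝ) * (x k : ℝ)‖ₑ = (x j : ℝ≥0∞) * (x k : ℝ≥0∞) := fun x => by
    rw [Real.enorm_eq_ofReal (by positivity), ENNReal.ofReal_mul (by positivity),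
      ENNReal.ofReal_natCast, ENNReal.ofReal_natCast]
  simp only [e, h]
  refine ENNReal.mul_lt_top ENNReal.coe_lt_top ?_
  simp only [Pi.add_apply, Nat.cast_add]
  rw [lintegral_add_left Measurable.of_discrete, h2]
  simp

/-- The centred linear statistic `∑ a_j (x_j - r_j)`. -/
noncomputable def centredSum (a : ι → ℝ) (r : ι → ℝ≥0) (x : ι → ℕ) : ℝ :=
  ∑ j, a j * ((x j : ℝ) - r j)

lemma centredSum_add_single [DecidableEq ι] (a : ι → ℝ) (r : ι → ℝ≥0) (x : ι → ℕ) (j : ι) :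
    centredSum a r (x + Pi.single j 1) = centredSum a r x + a j := by
  have : ∀ i, a i * (((x + Pi.single j 1 : ι → ℕ) i : ℝ) - r i)
      = a i * ((x i : ℝ) - r i) + if i = j then a i else 0 := by
    intro i
    rcases eq_or_ne i j with rfl | h
    · simp; ring
    · simp [h]
  simp only [centredSum, this, Finset.sum_add_distrib]
  simp

lemma integrable_centredSum (a : ι → ℝ) (r : ι → ℝ≥0) :
    Integrable (centredSum a r) (poissonVec r) := by
  unfold centredSum
  exact integrable_finsetSum _ fun j _ =>
    ((integrable_coord_poissonVec r j).sub (integrable_const _)).const_mul _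

lemma integrable_coord_mul_centredSum (a : ι → ℝ) (r : ι → ℝ≥0) (j : ι) :
    Integrable (fun x => (x j : ℝ) * centredSum a r x) (poissonVec r) := by
  simp only [centredSum, Finset.mul_sum]
  refine integrable_finsetSum _ fun k _ => ?_
  have := ((integrable_coord_mul_coord_poissonVec r j k).const_mul (a k)).sub
    ((integrable_coord_poissonVec r j).const_mul (a k * r k))
  refine this.congr (ae_of_all _ fun x => ?_)
  simp only [Pi.sub_apply]
  ring

lemma integrable_comp_centredSum (a : ι → ℝ) (r : ι → ℝ≥0) {F : ℝ → ℝ} {A B : ℝ}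
    (hF : ∀ w, |F w| ≤ A + B * |w|) :
    Integrable (fun x => F (centredSum a r x)) (poissonVec r) := by
  refine Integrable.mono' ((integrable_const A).add ((integrable_centredSum a r).abs.const_mul B))
    StronglyMeasurable.of_discrete.aestronglyMeasurable (ae_of_all _ fun x => ?_)
  exact hF _

lemma integrable_coord_mul_comp_centredSum (a : ι → ℝ) (r : ι → ℝ≥0) (j : ι) {F : ℝ → ℝ}
    {A B : ℝ} (hF : ∀ w, |F w| ≤ A + B * |w|) :
    Integrable (fun x => (x j : ℝ) * F (centredSum a r x)) (poissonVec r) := by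
  refine Integrable.mono' (((integrable_coord_poissonVec r j).const_mul A).add
    ((integrable_coord_mul_centredSum a r j).abs.const_mul B))
    StronglyMeasurable.of_discrete.aestronglyMeasurable (ae_of_all _ fun x => ?_)
  simp only [Pi.add_apply, Real.norm_eq_abs, abs_mul, Nat.abs_cast]
  have := mul_le_mul_of_nonneg_left (hF (centredSum a r x)) (Nat.cast_nonneg (α := ℝ) (x j))
  linarith

/-- Stein's identity for a linear statistic of independent Poisson counts. -/
lemma integral_centredSum_mul (a : ι → ℝ) (r : ι → ℝ≥0) {F : ℝ → ℝ} {A B : ℝ}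
    (hF : ∀ w, |F w| ≤ A + B * |w|) :
    ∫ x, centredSum a r x * F (centredSum a r x) ∂(poissonVec r) =
      ∑ j, a j * r j * ∫ x, (F (centredSum a r x + a j) - F (centredSum a r x))
        ∂(poissonVec r) := by
  classical
  have hi := integrable_comp_centredSum a r hF
  have e : ∀ x, centredSum a r x * F (centredSum a r x) =
      ∑ j, a j * ((x j : ℝ) * F (centredSum a r x) - r j * F (centredSum a r x)) := by
    intro x
    rw [show centredSum a r x * F (centredSum a r x) =
      (∑ j, a j * ((x j : ℝ) - r j)) * F (centredSum a r x) from rfl, Finset.sum_mul]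
    exact Finset.sum_congr rfl fun j _ => by ring
  have hij := fun j => integrable_coord_mul_comp_centredSum a r j hF
  simp only [e]
  rw [integral_finsetSum Finset.univ (f := fun j x =>
    a j * ((x j : ℝ) * F (centredSum a r x) - r j * F (centredSum a r x)))
    fun j _ => ((hij j).sub (hi.const_mul (r j : ℝ))).const_mul (a j)]
  refine Finset.sum_congr rfl fun j _ => ?_
  have hs : Integrable (fun x => F (centredSum a r x + a j)) (poissonVec r) := by
    refine integrable_comp_centredSum (F := fun w => F (w + a j)) a r
      (A := A + |B| * |a j|) (B := |B|) fun w => (hF _).trans ?_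
    have h1 : B * |w + a j| ≤ |B| * |w + a j| :=
      mul_le_mul_of_nonneg_right (le_abs_self B) (abs_nonneg _)
    have h2 := mul_le_mul_of_nonneg_left (abs_add_le w (a j)) (abs_nonneg B)
    linarith
  rw [integral_const_mul, integral_sub (hij j) (hi.const_mul _),
    integral_coord_mul_poissonVec r j fun x => F (centredSum a r x), integral_const_mul,
    integral_sub hs hi]
  simp only [centredSum_add_single]
  ring

variable {a : ι → ℝ} {r : ι → ℝ≥0}

lemma integral_centredSum_sq (hv : ∑ j, (r j : ℝ) * a j ^ 2 = 1) :
    ∫ x, centredSum a r x ^ 2 ∂(poissonVec r) = 1 := by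
  have h := integral_centredSum_mul a r (F := id) (A := 0) (B := 1) (fun w => by simp)
  simp only [id, add_sub_cancel_left, integral_const, probReal_univ, one_smul] at h
  simp only [sq]
  rw [h, ← hv]
  exact Finset.sum_congr rfl fun j _ => by ring

lemma integrable_centredSum_sq : Integrable (fun x => centredSum a r x ^ 2) (poissonVec r) := by
  have : ∀ x, centredSum a r x ^ 2 =
      ∑ j, (a j * ((x j : ℝ) * centredSum a r x) - a j * r j * centredSum a r x) := by
    intro x
    rw [sq, show centredSum a r x * centredSum a r x =
      (∑ j, a j * ((x j : ℝ) - r j)) * centredSum a r x from rfl, Finset.sum_mul]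
    exact Finset.sum_congr rfl fun j _ => by ring
  simp only [this]
  exact integrable_finsetSum _ fun j _ => ((integrable_coord_mul_centredSum a r j).const_mul _).sub
    ((integrable_centredSum a r).const_mul _)

lemma integral_abs_centredSum_le (hv : ∑ j, (r j : ℝ) * a j ^ 2 = 1) :
    ∫ x, |centredSum a r x| ∂(poissonVec r) ≤ 1 := by
  have h : ∫ x, |centredSum a r x| ∂(poissonVec r)
      ≤ ∫ x, (1 / 2 + 1 / 2 * centredSum a r x ^ 2) ∂(poissonVec r) := by
    refine integral_mono (integrable_centredSum a r).abs
      ((integrable_const _).add (integrable_centredSum_sq.const_mul _)) fun x => ?_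
    simp only
    nlinarith [sq_nonneg (|centredSum a r x| - 1), sq_abs (centredSum a r x)]
  rw [integral_add (integrable_const _) (integrable_centredSum_sq.const_mul _),
    integral_const_mul, integral_centredSum_sq hv] at h
  simp only [integral_const, probReal_univ, one_smul] at h
  linarith

/-- Concentration: a normalised Poisson linear statistic puts little mass on short intervals. -/
lemma measureReal_abs_centredSum_sub_le (hv : ∑ j, (r j : ℝ) * a j ^ 2 = 1) {γ : ℝ}
    (hγ : ∀ j, |a j| ≤ γ) (hγ0 : 0 ≤ γ) (x : ℝ) :
    (poissonVec r).real {y | |centredSum a r y - x| ≤ γ} ≤ 2 * γ := by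
  -- The test function is `w - x` clipped at `±2γ`. From a point within `γ` of `x`, a jump `|a j| ≤
  -- γ` stays in the linear range, so the increment of `F` is exactly `a j`; elsewhere monotonicity
  -- gives it the sign of `a j`. Stein's identity then bounds the mass of the interval by `E[W F(W)]
  -- ≤ 2γ E|W|`.
  set F : ℝ → ℝ := fun w => max (-(2 * γ)) (min (2 * γ) (w - x)) with hF
  have hFb : ∀ w, |F w| ≤ 2 * γ := fun w => by
    rw [abs_le]
    exact ⟨le_max_left _ _, max_le (by linarith) (min_le_left _ _)⟩
  have hmono : Monotone F := fun u v h => by simp only [hF]; gcongr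
  have hFb' : ∀ w, |F w| ≤ 2 * γ + 0 * |w| := fun w => by simpa using hFb w
  have h := integral_centredSum_mul a r hFb'
  set S := {y | |centredSum a r y - x| ≤ γ}
  have hup : ∫ y, centredSum a r y * F (centredSum a r y) ∂(poissonVec r) ≤ 2 * γ := by
    calc _ ≤ ∫ y, 2 * γ * |centredSum a r y| ∂(poissonVec r) := by
          refine integral_mono ?_ ((integrable_centredSum a r).abs.const_mul _) fun y => ?_
          · refine Integrable.mono' ((integrable_centredSum a r).abs.const_mul (2 * γ))
              StronglyMeasurable.of_discrete.aestronglyMeasurable (ae_of_all _ fun y => ?_)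
            rw [Real.norm_eq_abs, abs_mul, mul_comm]
            exact mul_le_mul_of_nonneg_right (hFb _) (abs_nonneg _)
          · refine (le_abs_self _).trans ?_
            rw [abs_mul, mul_comm]
            exact mul_le_mul_of_nonneg_right (hFb _) (abs_nonneg _)
      _ ≤ 2 * γ * 1 := by
          rw [integral_const_mul]
          exact mul_le_mul_of_nonneg_left (integral_abs_centredSum_le hv) (by linarith)
      _ = _ := mul_one _
  have hlow : ∀ j, a j ^ 2 * (poissonVec r).real S ≤
      a j * ∫ y, (F (centredSum a r y + a j) - F (centredSum a r y)) ∂(poissonVec r) := by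
    intro j
    rw [← integral_const_mul, mul_comm, ← smul_eq_mul,
      ← integral_indicator_const _ (MeasurableSet.of_discrete (s := S))]
    refine integral_mono ((integrable_const _).indicator .of_discrete) ?_ fun y => ?_
    · refine Integrable.mono' (integrable_const (|a j| * (2 * γ + 2 * γ)))
        StronglyMeasurable.of_discrete.aestronglyMeasurable (ae_of_all _ fun y => ?_)
      rw [Real.norm_eq_abs, abs_mul]
      gcongr
      exact (abs_sub _ _).trans (add_le_add (hFb _) (hFb _))
    · have haj := abs_le.1 (hγ j)
      by_cases hy : y ∈ S
      · rw [Set.indicator_of_mem hy]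
        have hy' := abs_le.1 (show |centredSum a r y - x| ≤ γ from hy)
        have e : ∀ u, -(2 * γ) ≤ u - x → u - x ≤ 2 * γ → F u = u - x := fun u h1 h2 => by
          simp only [hF]
          rw [min_eq_right h2, max_eq_right h1]
        rw [e _ (by linarith) (by linarith), e _ (by linarith) (by linarith)]
        exact le_of_eq (by ring)
      · rw [Set.indicator_of_notMem hy]
        rcases le_total 0 (a j) with h0 | h0
        · exact mul_nonneg h0 (sub_nonneg.2 (hmono (by linarith)))
        · exact mul_nonneg_of_nonpos_of_nonpos h0 (sub_nonpos.2 (hmono (by linarith)))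
  calc (poissonVec r).real S = ∑ j, (r j : ℝ) * (a j ^ 2 * (poissonVec r).real S) := by
        simp only [← mul_assoc]
        rw [← Finset.sum_mul, hv, one_mul]
    _ ≤ ∑ j, (r j : ℝ) * (a j * ∫ y, (F (centredSum a r y + a j) - F (centredSum a r y))
          ∂(poissonVec r)) :=
        Finset.sum_le_sum fun j _ => mul_le_mul_of_nonneg_left (hlow j) (r j).2
    _ = _ := by
        rw [h]
        exact Finset.sum_congr rfl fun j _ => by ring
    _ ≤ _ := hup

/-- The Berry–Esseen bound for normalised linear statistics of independent Poisson counts. -/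
theorem abs_measureReal_centredSum_le_sub (hv : ∑ j, (r j : ℝ) * a j ^ 2 = 1) {γ : ℝ}
    (hγ : ∀ j, |a j| ≤ γ) (hγ0 : 0 ≤ γ) (x : ℝ) :
    |(poissonVec r).real {y | centredSum a r y ≤ x} - gaussInt x / gaussTotal| ≤
      (10 + millsConst) * γ := by
  set W := centredSum a r
  set f := steinSol x
  set g := steinDeriv x
  have hfb : ∀ w, |f w| ≤ millsConst := fun w => by
    rw [abs_of_nonneg (steinSol_nonneg x w)]
    exact steinSol_le x w
  have hstein := integral_centredSum_mul a r (F := f) (A := millsConst) (B := 0)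
    fun w => by simpa using hfb w
  have hbi : ∀ {h : (ι → ℕ) → ℝ} (C : ℝ), (∀ y, |h y| ≤ C) → Integrable h (poissonVec r) :=
    fun {h} C hC => Integrable.mono' (integrable_const C)
      StronglyMeasurable.of_discrete.aestronglyMeasurable (ae_of_all _ hC)
  have hgi : Integrable (fun y => g (W y)) (poissonVec r) := hbi 2 fun y => abs_steinDeriv_le x _
  have hfi : Integrable (fun y => W y * f (W y)) (poissonVec r) :=
    hbi 1 fun y => abs_mul_steinSol_le x _
  have hdi : ∀ j, Integrable (fun y => f (W y + a j) - f (W y)) (poissonVec r) := fun j =>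
    hbi (millsConst + millsConst) fun y => (abs_sub _ _).trans (add_le_add (hfb _) (hfb _))
  have hprob : (poissonVec r).real {y | W y ≤ x} - gaussInt x / gaussTotal =
      ∫ y, g (W y) ∂(poissonVec r) - ∫ y, W y * f (W y) ∂(poissonVec r) := by
    rw [← integral_sub hgi hfi]
    have e : ∀ y, g (W y) - W y * f (W y) =
        Set.indicator {y | W y ≤ x} (fun _ => (1 : ℝ)) y - gaussInt x / gaussTotal := by
      intro y
      simp only [g, f, steinDeriv, Set.indicator_apply, Set.mem_ofPred_eq]
      ring
    simp only [e]
    rw [integral_sub ((integrable_const _).indicator .of_discrete) (integrable_const _),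
      integral_indicator_const _ .of_discrete]
    simp
  set S := {y | |W y - x| ≤ γ}
  -- The Taylor error integrates to `|a j| γ (2 E|W| + millsConst) + 4 |a j| P(|W - x| ≤ γ)`. With
  -- `E|W| ≤ 1` and the concentration bound `2γ` the constant is `2 + 8 + millsConst`.
  have hterm : ∀ j, |a j * ∫ y, g (W y) ∂(poissonVec r)
      - ∫ y, (f (W y + a j) - f (W y)) ∂(poissonVec r)| ≤ |a j| * ((10 + millsConst) * γ) := by
    intro j
    rw [← integral_const_mul, ← integral_sub (hgi.const_mul _) (hdi j)]
    have hpt : ∀ y, ‖a j * g (W y) - (f (W y + a j) - f (W y))‖ ≤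
        |a j| * γ * (2 * |W y| + millsConst) + 4 * |a j| * S.indicator (fun _ => (1 : ℝ)) y := by
      intro y
      rw [Real.norm_eq_abs, abs_sub_comm]
      refine (steinSol_taylor x (W y) (a j)).trans ?_
      refine add_le_add ?_ ?_
      · have := millsConst_pos
        rw [← sq_abs, sq]
        gcongr
        exact hγ j
      · refine mul_le_mul_of_nonneg_left ?_ (by positivity)
        simp only [Set.indicator_apply, S, Set.mem_ofPred_eq]
        split_ifs with h1 h2 h2
        · exact le_rfl
        · exact absurd (h1.trans (hγ j)) h2
        · exact zero_le_one
        · exact le_rfl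
    have hWi : Integrable (fun y => |W y|) (poissonVec r) := (integrable_centredSum a r).abs
    have hb1 : Integrable (fun y => |a j| * γ * (2 * |W y| + millsConst)) (poissonVec r) :=
      ((hWi.const_mul 2).add (integrable_const _)).const_mul _
    have hb2 : Integrable (fun y => 4 * |a j| * S.indicator (fun _ => (1 : ℝ)) y)
        (poissonVec r) := ((integrable_const _).indicator .of_discrete).const_mul _
    refine (norm_integral_le_of_norm_le (hb1.add hb2) (ae_of_all _ hpt)).trans ?_
    rw [integral_add' hb1 hb2, integral_const_mul, integral_const_mul,
      integral_add (hWi.const_mul 2) (integrable_const _), integral_const_mul,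
      integral_indicator_const _ .of_discrete]
    simp only [integral_const, probReal_univ, smul_eq_mul, mul_one, one_mul]
    have h1 : ∫ y, |W y| ∂(poissonVec r) ≤ 1 := integral_abs_centredSum_le hv
    have h2 : (poissonVec r).real S ≤ 2 * γ := measureReal_abs_centredSum_sub_le hv hγ hγ0 x
    calc _ ≤ |a j| * γ * (2 * 1 + millsConst) + 4 * |a j| * (2 * γ) := by gcongr
      _ = _ := by ring
  -- The unit variance `∑ r_j a_j² = 1` distributes `E g(W)` over the coordinates, to be compared
  -- with Stein's identity term by term.
  have hsum : ∫ y, g (W y) ∂(poissonVec r) - ∫ y, W y * f (W y) ∂(poissonVec r) =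
      ∑ j, (r j : ℝ) * a j * (a j * ∫ y, g (W y) ∂(poissonVec r)
      - ∫ y, (f (W y + a j) - f (W y)) ∂(poissonVec r)) := by
    rw [hstein]
    conv_lhs => rw [← one_mul (∫ y, g (W y) ∂(poissonVec r)), ← hv]
    rw [Finset.sum_mul, ← Finset.sum_sub_distrib]
    exact Finset.sum_congr rfl fun j _ => by ring
  rw [hprob, hsum]
  calc _ ≤ ∑ j, |(r j : ℝ) * a j * (a j * ∫ y, g (W y) ∂(poissonVec r)
      - ∫ y, (f (W y + a j) - f (W y)) ∂(poissonVec r))| := Finset.abs_sum_le_sum_abs _ _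
    _ ≤ ∑ j, (r j : ℝ) * a j ^ 2 * ((10 + millsConst) * γ) := by
        refine Finset.sum_le_sum fun j _ => ?_
        rw [abs_mul, abs_mul, NNReal.abs_eq]
        calc _ ≤ (r j : ℝ) * |a j| * (|a j| * ((10 + millsConst) * γ)) := by
              gcongr
              exact hterm j
          _ = _ := by rw [← sq_abs]; ring
    _ = _ := by rw [← Finset.sum_mul, hv, one_mul]

end PoissonVector

/-! ### Binomial thinning of Poisson counts. -/

/-- On boxes the integrand is a product of functions of independent coordinates, so the integral
factors. It serves both for thinning word by word and for attaching a ghost sample document by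
document. -/
lemma pi_bind_pi {ι X Y : Type*} [Fintype ι] [Countable X] [MeasurableSpace X]
    [MeasurableSingletonClass X] [MeasurableSpace Y] (μ : ι → Measure X)
    [∀ i, IsProbabilityMeasure (μ i)] (κ : ι → X → Measure Y)
    [∀ i x, IsProbabilityMeasure (κ i x)] :
    (Measure.pi μ).bind (fun x => Measure.pi fun i => κ i (x i)) =
      Measure.pi fun i => (μ i).bind (κ i) := by
  have : ∀ i, IsProbabilityMeasure ((μ i).bind (κ i)) := fun i => by
    refine ⟨?_⟩
    rw [Measure.bind_apply .univ Measurable.of_discrete.aemeasurable]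
    simp
  refine (Measure.pi_eq fun s hs => ?_).symm
  rw [Measure.bind_apply (MeasurableSet.univ_pi hs) Measurable.of_discrete.aemeasurable]
  simp only [Measure.pi_pi]
  rw [lintegral_prod_eq_prod_lintegral_of_indepFun (μ := Measure.pi μ) Finset.univ
    (fun i x => κ i (x i) (s i)) (iIndepFun_pi (X := fun i x => κ i x (s i)) fun i => Measurable.of_discrete.aemeasurable)
    fun i => Measurable.of_discrete]
  refine Finset.prod_congr rfl fun i _ => ?_
  rw [Measure.bind_apply (hs i) Measurable.of_discrete.aemeasurable,
    ← (measurePreserving_eval μ i).lintegral_comp Measurable.of_discrete]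

/-- Only `n = m + k` contributes; after cancelling factorials the sum over `m` is the exponential
series at `r (1 - p)`. -/
lemma hasSum_poisson_thinning (r p : ℝ) (k : ℕ) :
    HasSum (fun n : ℕ => Real.exp (-r) * r ^ n / n.factorial *
      ((n.choose k : ℝ) * p ^ k * (1 - p) ^ (n - k)))
      (Real.exp (-(p * r)) * (p * r) ^ k / k.factorial) := by
  rw [← (add_left_injective k).hasSum_iff]
  · have h := (NormedSpace.expSeries_div_hasSum_exp (r * (1 - p))).mul_left
      (Real.exp (-r) * (p * r) ^ k / k.factorial)
    rw [← Real.exp_eq_exp_ℝ] at h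
    rw [show Real.exp (-r) * (p * r) ^ k / k.factorial * Real.exp (r * (1 - p)) =
        Real.exp (-(p * r)) * (p * r) ^ k / k.factorial by
      rw [show Real.exp (-(p * r)) = Real.exp (-r) * Real.exp (r * (1 - p)) by
        rw [← Real.exp_add]; congr 1; ring]
      ring] at h
    convert! h using 1
    · funext m
      simp only [Function.comp_apply, Nat.add_sub_cancel]
      have h1 : ((m + k).choose k : ℝ) * m.factorial * k.factorial = (m + k).factorial := by
        have := Nat.add_choose_mul_factorial_mul_factorial m k
        exact_mod_cast this
      have h2 : ((m + k).factorial : ℝ) ≠ 0 := by positivity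
      have h3 : (m.factorial : ℝ) ≠ 0 := by positivity
      have h4 : (k.factorial : ℝ) ≠ 0 := by positivity
      rw [← h1] at h2 ⊢
      have h5 : ((m + k).choose k : ℝ) ≠ 0 := fun h => h2 (by rw [h]; ring)
      rw [mul_pow, mul_pow, pow_add]
      field_simp
  · intro n hn
    have : n < k := by
      by_contra h
      exact hn ⟨n - k, by simp only; omega⟩
    simp [Nat.choose_eq_zero_of_lt this]

/-- Binomial thinning of a Poisson count is again Poisson. -/
lemma poissonMeasure_bind_binomial (r : ℝ≥0) (p : unitInterval) :
    (poissonMeasure r).bind (fun n => binomial n p) =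
      poissonMeasure (unitInterval.toNNReal p * r) := by
  refine Measure.ext_of_singleton fun k => ?_
  rw [Measure.bind_apply (measurableSet_singleton k) Measurable.of_discrete.aemeasurable,
    poissonMeasure_singleton, poissonMeasure, lintegral_sum_measure]
  simp only [lintegral_smul_measure, lintegral_dirac, smul_eq_mul, binomial_singleton]
  have h := hasSum_poisson_thinning r p k
  have hp : (0 : ℝ) ≤ 1 - p := by linarith [p.2.2]
  have hp0 : (0 : ℝ) ≤ p := p.2.1
  have hnn : ∀ n : ℕ, 0 ≤ Real.exp (-r) * (r : ℝ) ^ n / n.factorial *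
      ((n.choose k : ℝ) * (p : ℝ) ^ k * (1 - p) ^ (n - k)) := fun n => by positivity
  have e : ∀ n : ℕ, ENNReal.ofReal (Real.exp (-r) * (r : ℝ) ^ n / n.factorial) *
      ENNReal.ofReal ((n.choose k : ℝ) * (p : ℝ) ^ k * (1 - p) ^ (n - k)) =
      ENNReal.ofReal (Real.exp (-r) * (r : ℝ) ^ n / n.factorial *
      ((n.choose k : ℝ) * (p : ℝ) ^ k * (1 - p) ^ (n - k))) := fun n =>
    (ENNReal.ofReal_mul (by positivity)).symm
  simp only [e]
  rw [← ENNReal.ofReal_tsum_of_nonneg hnn h.summable, h.tsum_eq]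
  simp

instance {d : ℕ} (δ : unitInterval) (x : Fin d → ℕ) : IsProbabilityMeasure (thin δ x) := by
  unfold thin; infer_instance

lemma poissonVec_bind_thin {d : ℕ} (r : Fin d → ℝ≥0) (δ : unitInterval) :
    (poissonVec r).bind (thin δ) =
      poissonVec fun j => unitInterval.toNNReal (unitInterval.symm δ) * r j := by
  unfold poissonVec
  simp only [← poissonMeasure_bind_binomial]
  exact pi_bind_pi (fun j => poissonMeasure (r j)) fun _ n => binomial n (unitInterval.symm δ)

/-! ### Risks of the topic model, decomposed over topics. -/

namespace PoissonTopicModel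

variable {d T : ℕ} (M : PoissonTopicModel d T)

/-- The topic model of the thinned documents: the same topics, with all rates scaled
by `1 - δ`. -/
noncomputable def thinned (δ : unitInterval) : PoissonTopicModel d T where
  labelLaw := M.labelLaw
  topicLaw := M.topicLaw
  rate τ j := unitInterval.toNNReal (unitInterval.symm δ) * M.rate τ j

lemma law_eq : M.law = M.latentLaw.toMeasure.bind fun p =>
    (poissonVec (M.rate p.2)).map fun x => (p.1, p.2, x) := rfl

lemma law_apply (A : Set (Example d T)) :
    M.law A = ∫⁻ p, poissonVec (M.rate p.2) {x | (p.1, p.2, x) ∈ A} ∂M.latentLaw.toMeasure := by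
  rw [law_eq, Measure.bind_apply .of_discrete Measurable.of_discrete.aemeasurable]
  refine lintegral_congr fun p => ?_
  rw [Measure.map_apply Measurable.of_discrete .of_discrete]
  rfl

instance : IsProbabilityMeasure M.law := by
  refine ⟨?_⟩
  rw [law_apply]
  simp

lemma dropoutLaw_eq (δ : unitInterval) : M.dropoutLaw δ = (M.thinned δ).law := by
  refine Measure.ext fun A _ => ?_
  rw [law_apply, dropoutLaw, Measure.bind_apply .of_discrete Measurable.of_discrete.aemeasurable,
    law_eq, Measure.lintegral_bind Measurable.of_discrete.aemeasurable
      Measurable.of_discrete.aemeasurable]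
  refine lintegral_congr fun p => ?_
  rw [lintegral_map Measurable.of_discrete Measurable.of_discrete]
  simp only [thinned]
  rw [← poissonVec_bind_thin, Measure.bind_apply .of_discrete Measurable.of_discrete.aemeasurable]
  refine lintegral_congr fun x => ?_
  rw [Measure.map_apply Measurable.of_discrete .of_discrete]
  rfl

/-- The joint probability of a label and a topic. -/
noncomputable def jointProb (y : Bool) (τ : Fin T) : ℝ := (M.latentLaw (y, τ)).toReal

lemma law_real (A : Set (Example d T)) :
    M.law.real A = ∑ τ, ∑ y, M.jointProb y τ *
      (poissonVec (M.rate τ)).real {x | (y, τ, x) ∈ A} := by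
  rw [measureReal_def, law_apply, lintegral_fintype, ENNReal.toReal_sum, Fintype.sum_prod_type,
    Finset.sum_comm]
  · refine Finset.sum_congr rfl fun τ _ => Finset.sum_congr rfl fun y _ => ?_
    rw [ENNReal.toReal_mul, PMF.toMeasure_apply_singleton _ _ (measurableSet_singleton _), mul_comm]
    rfl
  · intro p _
    exact ENNReal.mul_ne_top (measure_ne_top _ _) (measure_ne_top _ _)

lemma jointProb_nonneg (y : Bool) (τ : Fin T) : 0 ≤ M.jointProb y τ := ENNReal.toReal_nonneg

lemma topicProb_eq (τ : Fin T) : M.topicProb τ = M.jointProb true τ + M.jointProb false τ := by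
  rw [topicProb, law_real, Finset.sum_eq_single τ]
  · simp
  · intro σ _ h
    simp [topic, h]
  · simp

lemma sum_topicProb : ∑ τ, M.topicProb τ = 1 := by
  have h := M.law_real Set.univ
  simp only [probReal_univ, Set.mem_univ, Set.ofPred_true, mul_one, Fintype.sum_bool] at h
  simp only [topicProb_eq]
  exact h.symm

lemma labelProb_eq (c : Bool) (τ : Fin T) :
    M.labelProb c τ = M.jointProb c τ / M.topicProb τ := by
  rw [labelProb, measureReal_def, cond_apply .of_discrete, ENNReal.toReal_mul, ENNReal.toReal_inv,
    ← measureReal_def, ← measureReal_def, topicProb, inv_mul_eq_div]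
  congr 1
  rw [law_real, Finset.sum_eq_single τ]
  · rw [Finset.sum_eq_single c]
    · simp [label, topic]
    · intro b _ h
      simp [label, h]
    · simp
  · intro σ _ h
    simp [topic, h]
  · simp

lemma errMin_eq : M.errMin = ∑ τ, M.jointProb (!M.bestLabel τ) τ := by
  rw [errMin, law_real]
  refine Finset.sum_congr rfl fun τ _ => ?_
  cases h : M.bestLabel τ <;> simp [label, topic, h]

/-- The probability that the linear classifier misses the more likely label, given the topic. -/
noncomputable def missProb (w : Fin d → ℝ) (τ : Fin T) : ℝ :=
  (poissonVec (M.rate τ)).real {x | predict w x ≠ M.bestLabel τ}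

lemma missProb_nonneg (w : Fin d → ℝ) (τ : Fin T) : 0 ≤ M.missProb w τ := measureReal_nonneg

/-- Given the topic, the counts are independent of the label. With miss probability `m`, a topic
contributes `P[best] m + P[other] (1 - m)` to the error, and `P[other]` to `errMin`. -/
lemma err_sub_errMin (w : Fin d → ℝ) : M.err w - M.errMin =
    ∑ τ, (M.jointProb (M.bestLabel τ) τ - M.jointProb (!M.bestLabel τ) τ) * M.missProb w τ := by
  rw [err, errorRate, law_real, errMin_eq, ← Finset.sum_sub_distrib]
  refine Finset.sum_congr rfl fun τ _ => ?_
  have hc : (poissonVec (M.rate τ)).real {x | predict w x = M.bestLabel τ} =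
      1 - M.missProb w τ := by
    rw [missProb, ← probReal_compl_eq_one_sub .of_discrete]
    congr 1
    ext x
    simp
  have h1 : ∀ y : Bool, {x : Fin d → ℕ | (y, τ, x) ∈
      {z : Example d T | label z ≠ predict w (counts z)}} = {x | predict w x ≠ y} := fun y => by
    ext x
    exact ne_comm
  simp only [h1, Fintype.sum_bool]
  have h2 : {x : Fin d → ℕ | predict w x ≠ !M.bestLabel τ} = {x | predict w x = M.bestLabel τ} := by
    ext x
    simp only [Set.mem_ofPred_eq]
    cases predict w x <;> cases M.bestLabel τ <;> simp
  have hm : (poissonVec (M.rate τ)).real {x | predict w x ≠ M.bestLabel τ} = M.missProb w τ := rfl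
  cases h : M.bestLabel τ <;> rw [h] at hm hc h2 <;> simp only [Bool.not_true, Bool.not_false] at h2 ⊢
    <;> rw [hm, h2, hc] <;> ring

/-- The two conditional label probabilities sum to one, so the larger is at least `1/2 + α` and they
differ by at least `2α`. -/
lemma bestLabel_margin {α : ℝ} {τ : Fin T} (hτ : 0 < M.topicProb τ)
    (hα : ∀ c, α ≤ |M.labelProb c τ - 1 / 2|) :
    2 * α * M.topicProb τ ≤
      M.jointProb (M.bestLabel τ) τ - M.jointProb (!M.bestLabel τ) τ := by
  have hs := M.topicProb_eq τ
  have h := hα (M.bestLabel τ)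
  have hl : ∀ c, M.jointProb c τ = M.labelProb c τ * M.topicProb τ := fun c => by
    rw [labelProb_eq, div_mul_cancel₀ _ hτ.ne']
  have h1 : M.labelProb true τ + M.labelProb false τ = 1 := by
    have : (M.labelProb true τ + M.labelProb false τ) * M.topicProb τ = 1 * M.topicProb τ := by
      rw [add_mul, ← hl, ← hl, one_mul, hs]
    exact mul_right_cancel₀ hτ.ne' this
  have h2 : M.labelProb (!M.bestLabel τ) τ ≤ M.labelProb (M.bestLabel τ) τ ∧
      M.labelProb (M.bestLabel τ) τ + M.labelProb (!M.bestLabel τ) τ = 1 := by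
    unfold bestLabel
    by_cases h : M.labelProb false τ < M.labelProb true τ
    · simp only [h, decide_true, Bool.not_true]; exact ⟨h.le, h1⟩
    · simp only [h, decide_false, Bool.not_false]; exact ⟨not_lt.1 h, by linarith⟩
  rw [abs_of_nonneg (by linarith)] at h
  rw [hl, hl, ← sub_mul]
  exact mul_le_mul_of_nonneg_right (by linarith) hτ.le

lemma jointProb_sub_le (τ : Fin T) :
    M.jointProb (M.bestLabel τ) τ - M.jointProb (!M.bestLabel τ) τ ≤ M.topicProb τ := by
  have h0 := M.jointProb_nonneg true τ
  have h1 := M.jointProb_nonneg false τ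
  rw [topicProb_eq]
  cases M.bestLabel τ <;> simp <;> linarith

end PoissonTopicModel

/-! ### VC dimension and growth function of half-spaces. -/

/-- Homogeneous half-spaces in `ℝᵈ` do not shatter more than `d` points. -/
lemma card_le_of_shatters_halfspaces {ι : Type*} [Fintype ι] [DecidableEq ι] {d : ℕ}
    (v : ι → Fin d → ℝ) {𝒜 : Finset (Finset ι)}
    (h𝒜 : ∀ u ∈ 𝒜, ∃ w : Fin d → ℝ, ∀ i, i ∈ u ↔ 0 < ∑ j, w j * v i j) {s : Finset ι}
    (hs : 𝒜.Shatters s) : s.card ≤ d := by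
  by_contra! hlt
  have hdep : ¬ LinearIndepOn ℝ v (s : Set ι) := by
    intro h
    have := LinearIndependent.fintype_card_le_finrank h
    simp at this
    omega
  rw [not_linearIndepOn_finset_iff] at hdep
  obtain ⟨c, hc, i₀, hi₀, hne⟩ := hdep
  -- Take a dependence `∑ c_i v_i = 0`. Shattering yields `w` that is positive exactly where `c_i >
  -- 0`, so every term of `∑ c_i (w · v_i) = 0` is nonnegative. Points outside the half-space give
  -- only `w · v_i ≤ 0`, so a positive coefficient is needed for a strict contradiction.
  wlog hpos : 0 < c i₀ generalizing c
  · refine this (-c) ?_ (by simpa using hne) ?_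
    · simp only [Pi.neg_apply, neg_smul, Finset.sum_neg_distrib, hc, neg_zero]
    · have := lt_of_le_of_ne (not_lt.1 hpos) hne
      simpa using this
  obtain ⟨u, hu, hsu⟩ := hs (Finset.filter_subset (fun i => 0 < c i) s)
  obtain ⟨w, hw⟩ := h𝒜 u hu
  have hmem : ∀ i ∈ s, (0 < ∑ j, w j * v i j ↔ 0 < c i) := by
    intro i hi
    rw [← hw]
    have := Finset.ext_iff.1 hsu i
    simpa [hi] using this
  have hzero : ∑ i ∈ s, c i * ∑ j, w j * v i j = 0 := by
    have h1 : ∀ i, c i * ∑ j, w j * v i j = ∑ j, w j * (c i • v i) j := by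
      intro i
      rw [Finset.mul_sum]
      exact Finset.sum_congr rfl fun j _ => by simp only [Pi.smul_apply, smul_eq_mul]; ring
    simp only [h1]
    rw [Finset.sum_comm]
    simp only [← Finset.mul_sum, ← Finset.sum_apply, hc]
    simp
  refine absurd hzero (ne_of_gt (Finset.sum_pos' (fun i hi => ?_) ⟨i₀, hi₀, ?_⟩))
  · rcases le_or_gt (c i) 0 with h | h
    · exact mul_nonneg_of_nonpos_of_nonpos h
        (not_lt.1 fun h' => absurd ((hmem i hi).1 h') (not_lt.2 h))
    · exact (mul_pos h ((hmem i hi).2 h)).le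
  · exact mul_pos hpos ((hmem i₀ hi₀).2 hpos)

/-- With `x = d/m ≤ 1`, each `x^d` is at most `x^k` for `k ≤ d`, so `x^d` times the sum is at most
`(1 + x)^m ≤ e^d`. -/
lemma sum_choose_le {d m : ℕ} (hd : 0 < d) (hdm : d ≤ m) :
    (∑ k ∈ Finset.Iic d, (m.choose k : ℝ)) ≤ (Real.exp 1 * m / d) ^ d := by
  have hd' : (0 : ℝ) < d := by exact_mod_cast hd
  have hm' : (0 : ℝ) < m := by exact_mod_cast hd.trans_le hdm
  set x : ℝ := d / m
  have hx0 : 0 < x := by positivity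
  have hx1 : x ≤ 1 := (div_le_one hm').2 (by exact_mod_cast hdm)
  have h1 : x ^ d * ∑ k ∈ Finset.Iic d, (m.choose k : ℝ) ≤ (1 + x) ^ m := by
    rw [Finset.mul_sum, add_comm, add_pow]
    calc _ ≤ ∑ k ∈ Finset.Iic d, x ^ k * 1 ^ (m - k) * (m.choose k : ℝ) := by
          refine Finset.sum_le_sum fun k hk => ?_
          rw [one_pow, mul_one]
          exact mul_le_mul_of_nonneg_right (pow_le_pow_of_le_one hx0.le hx1 (Finset.mem_Iic.1 hk))
            (Nat.cast_nonneg _)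
      _ ≤ _ := by
          refine Finset.sum_le_sum_of_subset_of_nonneg (fun k hk => ?_) fun k _ _ => by positivity
          rw [Finset.mem_Iic] at hk
          exact Finset.mem_range.2 (by omega)
  have h2 : (1 + x) ^ m ≤ Real.exp d := by
    calc (1 + x) ^ m ≤ Real.exp x ^ m := by
          gcongr
          linarith [Real.add_one_le_exp x]
      _ = Real.exp d := by
          rw [← Real.exp_nat_mul]
          congr 1
          simp only [x]
          field_simp
  have h3 : (Real.exp 1 * m / d) ^ d = Real.exp d / x ^ d := by
    rw [show Real.exp 1 * m / d = Real.exp 1 / x by simp only [x]; field_simp, div_pow,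
      ← Real.exp_nat_mul, mul_one]
  rw [h3, le_div_iff₀ (by positivity), mul_comm]
  exact h1.trans h2

/-- The Sauer–Shelah lemma at VC dimension at most `d`. -/
lemma card_halfspaces_le {ι : Type*} [Fintype ι] [DecidableEq ι] {d : ℕ} (hd : 0 < d)
    (hdm : d ≤ Fintype.card ι) (v : ι → Fin d → ℝ) {𝒜 : Finset (Finset ι)}
    (h𝒜 : ∀ u ∈ 𝒜, ∃ w : Fin d → ℝ, ∀ i, i ∈ u ↔ 0 < ∑ j, w j * v i j) :
    (𝒜.card : ℝ) ≤ (Real.exp 1 * Fintype.card ι / d) ^ d := by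
  refine le_trans ?_ (sum_choose_le hd hdm)
  have hvc : 𝒜.vcDim ≤ d := Finset.sup_le fun s hs =>
    card_le_of_shatters_halfspaces v h𝒜 (Finset.mem_shatterer.1 hs)
  have h := (Finset.card_le_card_shatterer 𝒜).trans Finset.card_shatterer_le_sum_vcDim
  have h2 : 𝒜.card ≤ ∑ k ∈ Finset.Iic d, (Fintype.card ι).choose k :=
    h.trans (Finset.sum_le_sum_of_subset (Finset.Iic_subset_Iic.2 hvc))
  exact_mod_cast h2

/-! ### Rademacher averages and symmetrisation. -/

/-- The sign encoded by a Boolean. -/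
def boolSign (b : Bool) : ℝ := if b then 1 else -1

lemma sum_exp_signs_le {n : ℕ} (a : Fin n → ℝ) (ha : ∀ i, |a i| ≤ 1) (s : ℝ) :
    ∑ σ : Fin n → Bool, Real.exp (s * ∑ i, boolSign (σ i) * a i) ≤
      2 ^ n * Real.exp (s ^ 2 * n / 2) := by
  have h1 : ∀ σ : Fin n → Bool, Real.exp (s * ∑ i, boolSign (σ i) * a i) =
      ∏ i, Real.exp (s * (boolSign (σ i) * a i)) := fun σ => by
    rw [Finset.mul_sum, Real.exp_sum]
  simp only [h1]
  rw [← Fintype.prod_sum (f := fun i b => Real.exp (s * (boolSign b * a i)))]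
  calc _ ≤ ∏ _i : Fin n, 2 * Real.exp (s ^ 2 / 2) := by
        refine Finset.prod_le_prod (fun i _ => Finset.sum_nonneg fun b _ => (Real.exp_pos _).le)
          fun i _ => ?_
        have h2 := Real.cosh_le_exp_half_sq (s * a i)
        rw [Real.cosh_eq] at h2
        have h3 : Real.exp ((s * a i) ^ 2 / 2) ≤ Real.exp (s ^ 2 / 2) := by
          apply Real.exp_le_exp.2
          have : a i ^ 2 ≤ 1 := by
            rw [← sq_abs]
            exact pow_le_one₀ (abs_nonneg _) (ha i)
          nlinarith [sq_nonneg s]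
        simp only [Fintype.sum_bool, boolSign, if_true, Bool.false_eq_true, if_false, one_mul,
          neg_mul, mul_neg]
        linarith
    _ = _ := by
        rw [Finset.prod_const, Finset.card_univ, Fintype.card_fin, mul_pow, ← Real.exp_nat_mul]
        congr 2
        ring

/-- Massart's finite class lemma for Rademacher averages. -/
lemma sum_signs_le {n : ℕ} (hn : 0 < n) {A : Finset (Fin n → ℝ)} {N : ℝ} (hN : 1 ≤ N)
    (hcard : (A.card : ℝ) ≤ N) (hA : ∀ a ∈ A, ∀ i, |a i| ≤ 1) (X : (Fin n → Bool) → ℝ)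
    (hX : ∀ σ, ∃ a ∈ A, X σ ≤ |∑ i, boolSign (σ i) * a i|) :
    ∑ σ, X σ ≤ 2 ^ n * Real.sqrt (2 * n * Real.log (2 * N)) := by
  set l := Real.log (2 * N)
  have hl : 0 < l := Real.log_pos (by linarith)
  have hn' : (0 : ℝ) < n := by exact_mod_cast hn
  set s := Real.sqrt (2 * l / n)
  have hs : 0 < s := Real.sqrt_pos.2 (by positivity)
  have hs2 : s ^ 2 * n / 2 = l := by
    rw [Real.sq_sqrt (by positivity)]
    field_simp
  have hexp : Real.exp (-(2 * l)) * (2 * N) * Real.exp l = 1 := by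
    rw [show 2 * N = Real.exp l from (Real.exp_log (by linarith)).symm, ← Real.exp_add,
      ← Real.exp_add, show -(2 * l) + l + l = 0 by ring, Real.exp_zero]
  -- The inequality `1 + y ≤ e^y` at `y = s X - 2l` replaces Jensen's inequality. Averaged over
  -- signs, the exponential term is at most `e^{-2l} · 2N · e^l = 1`, where `2N` counts each vector
  -- with both signs; the choice of `s` makes `e^{s² n/2} = e^l`.
  have hpt : ∀ σ, s * X σ ≤ (2 * l - 1) + Real.exp (-(2 * l)) *
      ∑ a ∈ A, (Real.exp (s * ∑ i, boolSign (σ i) * a i) +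
        Real.exp (-s * ∑ i, boolSign (σ i) * a i)) := by
    intro σ
    obtain ⟨a, haA, haX⟩ := hX σ
    have h1 := Real.add_one_le_exp (s * X σ - 2 * l)
    have h2 : Real.exp (s * X σ) ≤ Real.exp (s * ∑ i, boolSign (σ i) * a i) +
        Real.exp (-s * ∑ i, boolSign (σ i) * a i) := by
      have h4 : s * X σ ≤ s * |∑ i, boolSign (σ i) * a i| := by gcongr
      refine (Real.exp_le_exp.2 h4).trans ?_
      rcases abs_choice (∑ i, boolSign (σ i) * a i) with h | h
      · rw [h]
        exact le_add_of_nonneg_right (Real.exp_pos _).le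
      · rw [h, mul_neg, ← neg_mul]
        exact le_add_of_nonneg_left (Real.exp_pos _).le
    have h3 := Finset.single_le_sum (f := fun a : Fin n → ℝ =>
      Real.exp (s * ∑ i, boolSign (σ i) * a i) + Real.exp (-s * ∑ i, boolSign (σ i) * a i))
      (fun a _ => by positivity) haA
    rw [sub_eq_add_neg, add_comm (s * X σ), Real.exp_add] at h1
    have h5 := mul_le_mul_of_nonneg_left (h2.trans h3) (Real.exp_pos (-(2 * l))).le
    linarith
  have hsum : s * ∑ σ, X σ ≤ 2 ^ n * (2 * l) := by
    rw [Finset.mul_sum]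
    refine (Finset.sum_le_sum fun σ _ => hpt σ).trans ?_
    rw [Finset.sum_add_distrib, ← Finset.mul_sum, Finset.sum_comm, Finset.sum_const,
      Finset.card_univ, Fintype.card_fun, Fintype.card_bool, Fintype.card_fin, nsmul_eq_mul]
    have h1 : ∑ a ∈ A, ∑ σ : Fin n → Bool, (Real.exp (s * ∑ i, boolSign (σ i) * a i) +
        Real.exp (-s * ∑ i, boolSign (σ i) * a i)) ≤ N * (2 * (2 ^ n * Real.exp l)) := by
      calc _ ≤ ∑ a ∈ A, 2 * (2 ^ n * Real.exp l) := by
            refine Finset.sum_le_sum fun a ha => ?_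
            rw [Finset.sum_add_distrib]
            have h1 := sum_exp_signs_le a (hA a ha) s
            have h2 := sum_exp_signs_le a (hA a ha) (-s)
            rw [neg_sq] at h2
            rw [hs2] at h1 h2
            linarith
        _ ≤ _ := by
            rw [Finset.sum_const, nsmul_eq_mul]
            gcongr
    have h2 := mul_le_mul_of_nonneg_left h1 (Real.exp_pos (-(2 * l))).le
    have h3 : Real.exp (-(2 * l)) * (N * (2 * (2 ^ n * Real.exp l))) = 2 ^ n := by
      calc _ = 2 ^ n * (Real.exp (-(2 * l)) * (2 * N) * Real.exp l) := by ring
        _ = _ := by rw [hexp, mul_one]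
    push_cast
    linarith
  have hfin : 2 * l = s * Real.sqrt (2 * n * l) := by
    rw [← Real.sqrt_mul (by positivity),
      show 2 * l / n * (2 * n * l) = (2 * l) ^ 2 by field_simp, Real.sqrt_sq (by positivity)]
  rw [hfin] at hsum
  refine le_of_mul_le_mul_left ?_ hs
  linarith

lemma bind_prod_const {X Y : Type*} [Countable X] [MeasurableSpace X] [MeasurableSingletonClass X]
    [MeasurableSpace Y] (μ : Measure X) [IsProbabilityMeasure μ] (k : X → Measure Y)
    [∀ x, IsProbabilityMeasure (k x)] (ρ : Measure Y) [IsProbabilityMeasure ρ]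
    [IsProbabilityMeasure (μ.bind k)] :
    μ.bind (fun x => (k x).prod ρ) = (μ.bind k).prod ρ := by
  refine (Measure.prod_eq fun s t hs ht => ?_).symm
  rw [Measure.bind_apply (hs.prod ht) Measurable.of_discrete.aemeasurable,
    Measure.bind_apply hs Measurable.of_discrete.aemeasurable]
  simp only [Measure.prod_prod]
  rw [lintegral_mul_const _ Measurable.of_discrete]

/-- Exchange the two entries of a pair unless `b` is true. -/
def condSwap {S : Type*} (b : Bool) (p : S × S) : S × S := if b then p else p.swap

lemma lintegral_pi_condSwap {S : Type*} [Countable S] [MeasurableSpace S]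
    [MeasurableSingletonClass S] {n : ℕ} (ρ : Measure S) [IsProbabilityMeasure ρ]
    (σ : Fin n → Bool) (H : (Fin n → S × S) → ℝ≥0∞) :
    ∫⁻ v, H (fun i => condSwap (σ i) (v i)) ∂(Measure.pi fun _ => ρ.prod ρ) =
      ∫⁻ v, H v ∂(Measure.pi fun _ => ρ.prod ρ) := by
  have hsw : ∀ b : Bool, (ρ.prod ρ).map (condSwap b) = ρ.prod ρ := by
    intro b
    cases b
    · exact Measure.prod_swap
    · exact Measure.map_id
  have : ∀ i, SigmaFinite ((ρ.prod ρ).map (condSwap (σ i))) := fun i => by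
    rw [hsw]; infer_instance
  have hmap := Measure.pi_map_pi (μ := fun _ : Fin n => ρ.prod ρ) (f := fun i => condSwap (σ i))
    fun i => Measurable.of_discrete.aemeasurable
  simp only [hsw] at hmap
  conv_rhs => rw [← hmap]
  rw [lintegral_map Measurable.of_discrete Measurable.of_discrete]

/-- The maximal deviation between two samples paired in `v`. -/
noncomputable def pairDeviation {Θ S : Type*} {n : ℕ} (G : Θ → S → ℝ) (v : Fin n → S × S) : ℝ≥0∞ :=
  ⨆ θ, ENNReal.ofReal |∑ i, (G θ (v i).1 - G θ (v i).2)|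

section Symmetrization

variable {Θ S : Type*} [Countable S] [MeasurableSpace S] [MeasurableSingletonClass S] {n : ℕ}
  {G : Θ → S → ℝ} {N : ℝ}

lemma lintegral_pairDeviation_le [Nonempty Θ] (hn : 0 < n) (hN : 1 ≤ N)
    (hcover : ∀ v : Fin n → S × S, ∃ A : Finset (Fin n → ℝ), (A.card : ℝ) ≤ N ∧
      (∀ a ∈ A, ∀ i, |a i| ≤ 1) ∧ ∀ θ, (fun i => G θ (v i).1 - G θ (v i).2) ∈ A)
    (ρ : Measure S) [IsProbabilityMeasure ρ] :
    ∫⁻ v, pairDeviation G v ∂(Measure.pi fun _ : Fin n => ρ.prod ρ) ≤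
      ENNReal.ofReal (Real.sqrt (2 * n * Real.log (2 * N))) := by
  set B := Real.sqrt (2 * n * Real.log (2 * N))
  -- Averaging over all swaps within pairs turns the deviation into a sign average over the finitely
  -- many loss patterns on `v`; `ρ.prod ρ` is invariant under these swaps.
  have hpt : ∀ v : Fin n → S × S,
      ∑ σ : Fin n → Bool, pairDeviation G (fun i => condSwap (σ i) (v i)) ≤
        ENNReal.ofReal (2 ^ n * B) := by
    intro v
    obtain ⟨A, hcard, hA, hmem⟩ := hcover v
    have hne : A.Nonempty := ⟨_, hmem (Classical.arbitrary Θ)⟩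
    set X : (Fin n → Bool) → ℝ := fun σ => A.sup' hne fun a => |∑ i, boolSign (σ i) * a i|
    have hX := sum_signs_le hn hN hcard hA X fun σ => by
      obtain ⟨a, ha, h⟩ := A.exists_mem_eq_sup' hne fun a => |∑ i, boolSign (σ i) * a i|
      exact ⟨a, ha, h.le⟩
    have hX0 : ∀ σ, 0 ≤ X σ := fun σ => by
      obtain ⟨a, ha⟩ := id hne
      have h := Finset.le_sup' (fun a : Fin n → ℝ => |∑ i, boolSign (σ i) * a i|) ha
      exact (abs_nonneg (∑ i, boolSign (σ i) * a i)).trans h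
    refine le_trans ?_ (ENNReal.ofReal_le_ofReal hX)
    rw [ENNReal.ofReal_sum_of_nonneg fun σ _ => hX0 σ]
    refine Finset.sum_le_sum fun σ _ => iSup_le fun θ => ENNReal.ofReal_le_ofReal ?_
    have h := Finset.le_sup' (fun a : Fin n → ℝ => |∑ i, boolSign (σ i) * a i|) (hmem θ)
    refine le_trans (le_of_eq ?_) h
    congr 1
    refine Finset.sum_congr rfl fun i _ => ?_
    cases hb : σ i <;> simp [condSwap, boolSign, hb]
  have h2 : (2 : ℝ≥0∞) ^ n * ∫⁻ v, pairDeviation G v ∂(Measure.pi fun _ : Fin n => ρ.prod ρ) ≤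
      2 ^ n * ENNReal.ofReal B := by
    calc _ = ∑ σ : Fin n → Bool, ∫⁻ v, pairDeviation G (fun i => condSwap (σ i) (v i))
          ∂(Measure.pi fun _ : Fin n => ρ.prod ρ) := by
          simp only [lintegral_pi_condSwap]
          simp
      _ = ∫⁻ v, ∑ σ : Fin n → Bool, pairDeviation G (fun i => condSwap (σ i) (v i))
          ∂(Measure.pi fun _ : Fin n => ρ.prod ρ) :=
          (lintegral_finsetSum _ fun σ _ => Measurable.of_discrete).symm
      _ ≤ ∫⁻ _, ENNReal.ofReal (2 ^ n * B) ∂(Measure.pi fun _ : Fin n => ρ.prod ρ) :=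
          lintegral_mono hpt
      _ = _ := by
          simp only [lintegral_const, measure_univ, mul_one]
          rw [ENNReal.ofReal_mul (by positivity), ENNReal.ofReal_pow (by norm_num)]
          simp
  exact (ENNReal.mul_le_mul_iff_right (by positivity) (by simp)).1 h2

/-- A uniform law of large numbers for losses that are averaged over an auxiliary kernel. -/
theorem measure_exists_lt_abs_sum_sub_le [Nonempty Θ] (hn : 0 < n) (hN : 1 ≤ N)
    (hG : ∀ θ s, |G θ s| ≤ 1)
    (hcover : ∀ v : Fin n → S × S, ∃ A : Finset (Fin n → ℝ), (A.card : ℝ) ≤ N ∧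
      (∀ a ∈ A, ∀ i, |a i| ≤ 1) ∧ ∀ θ, (fun i => G θ (v i).1 - G θ (v i).2) ∈ A)
    {X : Type*} [Countable X] [MeasurableSpace X] [MeasurableSingletonClass X]
    (μ : Measure X) [IsProbabilityMeasure μ] (k : X → Measure S)
    [∀ x, IsProbabilityMeasure (k x)] [IsProbabilityMeasure (μ.bind k)] {t : ℝ} (ht : 0 < t) :
    (Measure.pi fun _ : Fin n => μ) {z | ∃ θ, t <
      |∑ i, (∫ s, G θ s ∂(k (z i)) - ∫ s, G θ s ∂(μ.bind k))|} ≤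
      ENNReal.ofReal (Real.sqrt (2 * n * Real.log (2 * N)) / t) := by
  set ρ := μ.bind k
  set q : (Fin n → X) → Measure (Fin n → S × S) := fun z => Measure.pi fun i => (k (z i)).prod ρ
  -- Given `z`, the deviation is the mean over `q z` of the difference between an auxiliary draw
  -- from `k (z i)` and an independent ghost draw from `ρ`. The modulus and the supremum over `θ`
  -- then move inside the integral.
  have hpt : ∀ z θ, ENNReal.ofReal |∑ i, (∫ s, G θ s ∂(k (z i)) - ∫ s, G θ s ∂ρ)| ≤
      ∫⁻ v, pairDeviation G v ∂(q z) := by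
    intro z θ
    have hGi : ∀ (m : Measure S) [IsProbabilityMeasure m], Integrable (G θ) m := fun m _ =>
      Integrable.mono' (integrable_const 1) StronglyMeasurable.of_discrete.aestronglyMeasurable
        (ae_of_all _ (hG θ))
    have hdi : ∀ i, Integrable (fun p : S × S => G θ p.1 - G θ p.2) ((k (z i)).prod ρ) := fun i =>
      ((hGi (k (z i))).comp_fst ρ).sub ((hGi ρ).comp_snd (k (z i)))
    have e : ∑ i, (∫ s, G θ s ∂(k (z i)) - ∫ s, G θ s ∂ρ) =
        ∫ v, ∑ i, (G θ (v i).1 - G θ (v i).2) ∂(q z) := by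
      rw [integral_finsetSum Finset.univ
        (f := fun (i : Fin n) (v : Fin n → S × S) => G θ (v i).1 - G θ (v i).2)
        fun i _ => integrable_comp_eval (μ := fun i => (k (z i)).prod ρ) (hdi i)]
      refine Finset.sum_congr rfl fun i _ => ?_
      have h1 := integral_comp_eval (μ := fun i => (k (z i)).prod ρ) (i := i)
        (hdi i).aestronglyMeasurable
      refine Eq.symm (h1.trans ?_)
      rw [integral_sub ((hGi (k (z i))).comp_fst ρ) ((hGi ρ).comp_snd (k (z i))),
        integral_fun_fst, integral_fun_snd]
      simp
    rw [e, ← Real.enorm_eq_ofReal_abs]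
    refine (enorm_integral_le_lintegral_enorm _).trans (lintegral_mono fun v => ?_)
    rw [Real.enorm_eq_ofReal_abs]
    exact le_iSup (fun θ => ENNReal.ofReal |∑ i, (G θ (v i).1 - G θ (v i).2)|) θ
  -- Once `z` is averaged out, each auxiliary draw has law `ρ`, so the pairs become i.i.d. from
  -- `ρ.prod ρ` and the symmetric bound applies.
  have hq : ∫⁻ z, ∫⁻ v, pairDeviation G v ∂(q z) ∂(Measure.pi fun _ : Fin n => μ) =
      ∫⁻ v, pairDeviation G v ∂(Measure.pi fun _ : Fin n => ρ.prod ρ) := by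
    rw [← Measure.lintegral_bind Measurable.of_discrete.aemeasurable
      Measurable.of_discrete.aemeasurable]
    congr 1
    rw [pi_bind_pi (fun _ : Fin n => μ) fun _ x => (k x).prod ρ]
    congr 1
    funext _
    exact bind_prod_const μ k ρ
  have hB := lintegral_pairDeviation_le hn hN hcover ρ
  rw [← hq] at hB
  have hsub : {z : Fin n → X | ∃ θ, t < |∑ i, (∫ s, G θ s ∂(k (z i)) - ∫ s, G θ s ∂ρ)|} ⊆
      {z | ENNReal.ofReal t ≤ ∫⁻ v, pairDeviation G v ∂(q z)} := by
    rintro z ⟨θ, hθ⟩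
    exact (ENNReal.ofReal_le_ofReal hθ.le).trans (hpt z θ)
  refine (measure_mono hsub).trans ?_
  rw [ENNReal.ofReal_div_of_pos ht]
  refine (meas_ge_le_lintegral_div Measurable.of_discrete.aemeasurable ?_
    ENNReal.ofReal_ne_top).trans (ENNReal.div_le_div_right hB _)
  simpa using ht

end Symmetrization

/-! ### Normal approximation for linear classifiers. -/

/-- The standardised mean of the linear statistic `∑ w_j x_j` of independent Poisson counts. -/
noncomputable def zScore {ι : Type*} [Fintype ι] (r : ι → ℝ≥0) (w : ι → ℝ) : ℝ :=
  (∑ j, (r j : ℝ) * w j) / Real.sqrt (∑ j, (r j : ℝ) * w j ^ 2)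

/-- Scaling the rates by `c` multiplies the mean by `c` but the standard deviation only by `√c`. -/
lemma zScore_mul {ι : Type*} [Fintype ι] (c : ℝ≥0) (r : ι → ℝ≥0) (w : ι → ℝ) :
    zScore (fun j => c * r j) w = Real.sqrt c * zScore r w := by
  have h1 : ∑ j, ((c * r j : ℝ≥0) : ℝ) * w j = c * ∑ j, (r j : ℝ) * w j := by
    rw [Finset.mul_sum]
    exact Finset.sum_congr rfl fun j _ => by push_cast; ring
  have h2 : ∑ j, ((c * r j : ℝ≥0) : ℝ) * w j ^ 2 = c * ∑ j, (r j : ℝ) * w j ^ 2 := by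
    rw [Finset.mul_sum]
    exact Finset.sum_congr rfl fun j _ => by push_cast; ring
  rw [zScore, zScore, h1, h2, Real.sqrt_mul (NNReal.coe_nonneg c), mul_div_mul_comm, Real.div_sqrt]

/-- The normal approximation of the probability that a linear classifier does not output `b` on
a vector of independent Poisson counts. -/
lemma abs_measureReal_predict_ne_sub_le {d : ℕ} {r : Fin d → ℝ≥0} {w : Fin d → ℝ} {κ : ℝ}
    (hv : 0 < ∑ j, (r j : ℝ) * w j ^ 2) (hr : 0 < ∑ j, (r j : ℝ))
    (hκ : ∀ j, w j ^ 2 * ∑ j, (r j : ℝ) ≤ κ * ∑ j, (r j : ℝ) * w j ^ 2) (b : Bool) :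
    |(poissonVec r).real {x | predict w x ≠ b} -
      gaussInt (-(boolSign b * zScore r w)) / gaussTotal| ≤
      (10 + millsConst) * Real.sqrt (κ / ∑ j, (r j : ℝ)) := by
  set v := ∑ j, (r j : ℝ) * w j ^ 2
  set a : Fin d → ℝ := fun j => w j / Real.sqrt v
  have hsv : 0 < Real.sqrt v := Real.sqrt_pos.2 hv
  have hav : ∑ j, (r j : ℝ) * a j ^ 2 = 1 := by
    simp only [a, div_pow, Real.sq_sqrt hv.le, ← mul_div_assoc]
    rw [← Finset.sum_div]
    exact div_self hv.ne'
  have haγ : ∀ j, |a j| ≤ Real.sqrt (κ / ∑ j, (r j : ℝ)) := by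
    intro j
    apply Real.abs_le_sqrt
    simp only [a, div_pow, Real.sq_sqrt hv.le]
    rw [div_le_div_iff₀ hv hr]
    exact hκ j
  have hiff : ∀ x : Fin d → ℕ, centredSum a r x ≤ -zScore r w ↔ ∑ j, w j * (x j : ℝ) ≤ 0 := by
    intro x
    have : centredSum a r x + zScore r w = (∑ j, w j * (x j : ℝ)) / Real.sqrt v := by
      rw [centredSum, zScore, Finset.sum_div, Finset.sum_div, ← Finset.sum_add_distrib]
      refine Finset.sum_congr rfl fun j _ => ?_
      simp only [a]
      ring
    rw [← sub_nonpos, sub_neg_eq_add, this]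
    rw [div_le_iff₀ hsv, zero_mul]
  have hBE := abs_measureReal_centredSum_le_sub hav haγ (Real.sqrt_nonneg _) (-zScore r w)
  simp only [hiff] at hBE
  cases b
  -- The event is the complement of the one in the Berry–Esseen bound, so the symmetry `Φ(x) + Φ(-x)
  -- = 1` is used.
  · have e : {x : Fin d → ℕ | predict w x ≠ false} = {x | ∑ j, w j * (x j : ℝ) ≤ 0}ᶜ := by
      ext x
      simp [predict]
    rw [e, probReal_compl_eq_one_sub .of_discrete]
    have h2 := gaussInt_div_add (-zScore r w)
    have h3 : -(boolSign false * zScore r w) = - -zScore r w := by simp [boolSign]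
    rw [h3, ← abs_neg]
    convert hBE using 2
    linarith
  · have e : {x : Fin d → ℕ | predict w x ≠ true} = {x | ∑ j, w j * (x j : ℝ) ≤ 0} := by
      ext x
      simp [predict]
    rw [e]
    simpa [boolSign] using hBE

/-! ### From dropout error to error on full documents. -/

section Transfer

variable {δ : ℝ}

/-- The excess risk rate in terms of `D = d / n`. -/
noncomputable def ratioRate (D lam δ : ℝ) : ℝ :=
  Real.sqrt ((D + 1 / lam ^ (1 - δ)) * max 1 (-Real.log D) ^ (1 + δ)) ^ (1 / (1 - δ))

/-- The exponents cancel: `√(1/λ^(1-δ))^(1/(1-δ)) = 1/√λ`. The rate thus absorbs the normal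
approximation error on full documents. -/
lemma inv_sqrt_le_ratioRate (hδ₀ : 0 < δ) (hδ₁ : δ < 1) {D lam : ℝ} (hD : 0 ≤ D)
    (hlam : 0 < lam) : 1 / Real.sqrt lam ≤ ratioRate D lam δ := by
  have hc : 0 < 1 - δ := by linarith
  have hL : 1 ≤ max 1 (-Real.log D) ^ (1 + δ) :=
    Real.one_le_rpow (le_max_left _ _) (by linarith)
  have hp : 0 < lam ^ (1 - δ) := Real.rpow_pos_of_pos hlam _
  have h1 : 1 / lam ^ (1 - δ) ≤ (D + 1 / lam ^ (1 - δ)) * max 1 (-Real.log D) ^ (1 + δ) := by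
    have : 0 < 1 / lam ^ (1 - δ) := by positivity
    nlinarith
  calc 1 / Real.sqrt lam = Real.sqrt (1 / lam ^ (1 - δ)) ^ (1 / (1 - δ)) := by
        rw [one_div, one_div (lam ^ _), ← Real.rpow_neg hlam.le, Real.sqrt_eq_rpow,
          Real.sqrt_eq_rpow, ← Real.rpow_mul hlam.le, ← Real.rpow_mul hlam.le,
          ← Real.rpow_neg hlam.le]
        congr 1
        field_simp
    _ ≤ _ := by
        unfold ratioRate
        gcongr

lemma one_le_ratioRate (hδ₀ : 0 < δ) (hδ₁ : δ < 1) {D lam : ℝ} (hD : 0 ≤ D)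
    (hlam : 0 < lam) (h : 1 ≤ D ∨ lam ≤ 1) : 1 ≤ ratioRate D lam δ := by
  have hc : 0 < 1 - δ := by linarith
  have hL : 1 ≤ max 1 (-Real.log D) ^ (1 + δ) :=
    Real.one_le_rpow (le_max_left _ _) (by linarith)
  have hp : 0 < lam ^ (1 - δ) := Real.rpow_pos_of_pos hlam _
  have h1 : 1 ≤ D + 1 / lam ^ (1 - δ) := by
    rcases h with h | h
    · have : 0 < 1 / lam ^ (1 - δ) := by positivity
      linarith
    · have : 1 ≤ 1 / lam ^ (1 - δ) := by
        rw [le_div_iff₀ hp, one_mul]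
        exact Real.rpow_le_one hlam.le h hc.le
      linarith
  refine Real.one_le_rpow (Real.one_le_sqrt.2 ?_) (by positivity)
  nlinarith

/-- The rectangle bound with width `1/u`; the exponent `3/2` comes from `(su + 1/u)² = s²u² + 2s +
1/u² ≤ s²u² + 3`. -/
lemma exp_le_mul_gaussInt_neg {s u : ℝ} (hs0 : 0 ≤ s) (hs1 : s ≤ 1) (hu : 1 ≤ u) :
    Real.exp (-(s ^ 2 * u ^ 2) / 2) ≤ Real.exp (3 / 2) * (u * gaussInt (-(s * u))) := by
  have hu0 : 0 < u := by linarith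
  have h2 := mul_exp_le_gaussInt_neg (x := s * u) (r := u⁻¹) (by positivity) (by positivity)
  have h3 : -(s ^ 2 * u ^ 2) / 2 ≤ 3 / 2 + -(s * u + u⁻¹) ^ 2 / 2 := by
    have h4 : u⁻¹ ^ 2 ≤ 1 := pow_le_one₀ (by positivity) (inv_le_one_of_one_le₀ hu)
    have h6 : (s * u + u⁻¹) ^ 2 = s ^ 2 * u ^ 2 + 2 * s * (u * u⁻¹) + u⁻¹ ^ 2 := by ring
    rw [h6, mul_inv_cancel₀ hu0.ne']
    linarith
  calc _ ≤ Real.exp (3 / 2 + -(s * u + u⁻¹) ^ 2 / 2) := Real.exp_le_exp.2 h3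
    _ = Real.exp (3 / 2) * ((u * u⁻¹) * Real.exp (-(s * u + u⁻¹) ^ 2 / 2)) := by
      rw [Real.exp_add, mul_inv_cancel₀ hu0.ne', one_mul]
    _ = Real.exp (3 / 2) * (u * (u⁻¹ * Real.exp (-(s * u + u⁻¹) ^ 2 / 2))) := by ring
    _ ≤ Real.exp (3 / 2) * (u * gaussInt (-(s * u))) := by gcongr

/-- The altitude training effect: under a normal approximation, a small dropout error forces a
much smaller error on the original documents. -/
lemma exists_tail_transfer (hδ₀ : 0 < δ) (hδ₁ : δ < 1) {C₁ A : ℝ} (hC₁ : 0 ≤ C₁) (hA : 0 ≤ A) :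
    ∃ C : ℝ, 0 < C ∧ ∀ u p p' D lam : ℝ, 0 < D → 1 ≤ lam →
      p ≤ gaussInt (-u) / gaussTotal + C₁ / Real.sqrt lam →
      gaussInt (-(Real.sqrt (1 - δ) * u)) / gaussTotal ≤ p' + C₁ / Real.sqrt lam →
      p' ≤ A * (Real.sqrt (D * max 1 (-Real.log D)) + 1 / Real.sqrt lam) →
      p ≤ C * ratioRate D lam δ := by
  set c := 1 - δ
  have hc : 0 < c := by simp only [c]; linarith
  have hc1 : c < 1 := by simp only [c]; linarith
  set s := Real.sqrt c
  have hs0 : 0 < s := Real.sqrt_pos.2 hc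
  have hs1 : s ≤ 1 := Real.sqrt_le_one.2 hc1.le
  have hs2 : s ^ 2 = c := Real.sq_sqrt hc.le
  have hN := gaussTotal_pos
  set N := gaussTotal
  set A' := 2 * (A + C₁)
  have hA' : 0 ≤ A' := by positivity
  set h0 := gaussInt (-1) / N
  have hh0 : 0 < h0 := div_pos (gaussInt_pos _) hN
  set E := N⁻¹ ^ c * (Real.exp (3 / 2) * N * A' * (c⁻¹) ^ (δ / 2))
  have hE : 0 ≤ E := by positivity
  -- The first three summands serve the three cases of `hkey`: `u ≤ 1`, moderate `u`, and large `u`.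
  set B := A' / h0 + E + N⁻¹ ^ c + 1
  have hB : 0 < B := by positivity
  refine ⟨B ^ (1 / c) + C₁, by positivity, fun u p p' D lam hD hlam hp hq hp' => ?_⟩
  have hlam0 : 0 < lam := by linarith
  set L := max 1 (-Real.log D)
  have hL1 : 1 ≤ L := le_max_left _ _
  have hL0 : 0 < L := by linarith
  set R := (D + 1 / lam ^ c) * L ^ (1 + δ)
  set q := gaussInt (-u) / N
  set h := gaussInt (-(s * u)) / N
  have hq0 : 0 < q := div_pos (gaussInt_pos _) hN
  have hh : 0 < h := div_pos (gaussInt_pos _) hN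
  set Q := Real.sqrt ((D + 1 / lam) * L)
  have hil : 1 / lam ≤ 1 / lam ^ c := by
    apply one_div_le_one_div_of_le (by positivity)
    calc lam ^ c ≤ lam ^ (1 : ℝ) := Real.rpow_le_rpow_of_exponent_le hlam hc1.le
      _ = lam := Real.rpow_one _
  have hlp : 0 < 1 / lam := by positivity
  have hLL : L ≤ L ^ (1 + δ) := by
    calc L = L ^ (1 : ℝ) := (Real.rpow_one _).symm
      _ ≤ _ := Real.rpow_le_rpow_of_exponent_le hL1 (by linarith)
  have hQR : Q ≤ Real.sqrt R := by
    apply Real.sqrt_le_sqrt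
    simp only [R]
    gcongr
  have hQLR : Q * L ^ (δ / 2) ≤ Real.sqrt R := by
    have : L ^ (δ / 2) = Real.sqrt (L ^ δ) := by
      rw [Real.sqrt_eq_rpow, ← Real.rpow_mul hL0.le]
      congr 1
      ring
    rw [this, ← Real.sqrt_mul (by positivity)]
    apply Real.sqrt_le_sqrt
    simp only [R]
    rw [Real.rpow_add hL0, Real.rpow_one, ← mul_assoc]
    gcongr
  have hDR : Real.sqrt D ≤ Real.sqrt R := by
    apply Real.sqrt_le_sqrt
    simp only [R]
    have : 0 < 1 / lam ^ c := by positivity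
    nlinarith
  have hhQ : h ≤ A' * Q := by
    have h1 : Real.sqrt (D * L) ≤ Q := by
      apply Real.sqrt_le_sqrt
      gcongr
      linarith
    have h2 : 1 / Real.sqrt lam ≤ Q := by
      rw [← Real.sqrt_one, ← Real.sqrt_div zero_le_one]
      apply Real.sqrt_le_sqrt
      nlinarith
    have h3 : C₁ / Real.sqrt lam = C₁ * (1 / Real.sqrt lam) := by ring
    rw [h3] at hq
    have h4 : A * (Real.sqrt (D * L) + 1 / Real.sqrt lam) ≤ A * (Q + Q) := by gcongr
    have h5 : C₁ * (1 / Real.sqrt lam) ≤ C₁ * Q := by gcongr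
    have h6 : 0 ≤ C₁ * Q := by positivity
    simp only [A']
    linarith
  have hNc : 0 < N⁻¹ ^ c := by positivity
  have hAh : 0 ≤ A' / h0 := by positivity
  have hsR : 0 ≤ Real.sqrt R := Real.sqrt_nonneg _
  have hkey : q ^ c ≤ B * Real.sqrt R := by
    rcases le_or_gt u 1 with hu | hu
    -- For `u ≤ 1` the dropout tail `h` is bounded below, so `√R` is too, and the trivial bound `q ≤
    -- 1` suffices.
    · have h1 : h0 ≤ h := by
        simp only [h0, h]
        gcongr
        apply gaussInt_mono
        have : s * u ≤ 1 := by
          rcases le_total u 0 with h | h <;> nlinarith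
        linarith
      have h2 : q ^ c ≤ 1 :=
        Real.rpow_le_one hq0.le ((div_le_one hN).2 (gaussInt_le_total _)) hc.le
      have h3 : 1 ≤ A' / h0 * Real.sqrt R := by
        rw [div_mul_eq_mul_div, le_div_iff₀ hh0, one_mul]
        exact h1.trans (hhQ.trans (by gcongr))
      refine h2.trans (h3.trans (mul_le_mul_of_nonneg_right ?_ hsR))
      linarith
    · have hu0 : 0 < u := by linarith
      have hqu : q ≤ N⁻¹ * (Real.exp (-u ^ 2 / 2) * u⁻¹) := by
        have := mul_gaussInt_neg_le hu0
        simp only [q]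
        rw [div_eq_inv_mul]
        gcongr
        rw [← div_eq_mul_inv, le_div_iff₀ hu0]
        linarith
      have hqc : q ^ c ≤ N⁻¹ ^ c * (Real.exp (-(c * u ^ 2) / 2) * (u⁻¹) ^ c) := by
        calc q ^ c ≤ (N⁻¹ * (Real.exp (-u ^ 2 / 2) * u⁻¹)) ^ c := by gcongr
          _ = _ := by
            rw [Real.mul_rpow (by positivity) (by positivity),
              Real.mul_rpow (by positivity) (by positivity), ← Real.exp_mul]
            congr 3
            ring
      -- Comparing the tails gives `q^c ≲ u^δ h`. While `c u² ≤ L` the factor `u^δ` is at most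
      -- `(L/c)^(δ/2)`, which raises the logarithm's exponent from `1` to `1 + δ`. Beyond that
      -- threshold `e^{-cu²/2} ≤ √D` already.
      rcases le_or_gt (c * u ^ 2) L with hcu | hcu
      · have h1 : Real.exp (-(c * u ^ 2) / 2) ≤ Real.exp (3 / 2) * N * (u * h) := by
          have h2 := exp_le_mul_gaussInt_neg hs0.le hs1 hu.le
          have h7 : N * (u * h) = u * gaussInt (-(s * u)) := by
            rw [mul_left_comm, mul_div_cancel₀ _ hN.ne']
          rw [hs2, ← h7, ← mul_assoc] at h2
          exact h2
        have h8 : u * (u⁻¹) ^ c ≤ (c⁻¹) ^ (δ / 2) * L ^ (δ / 2) := by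
          have h9 : u * (u⁻¹) ^ c = (u ^ 2) ^ (δ / 2) := by
            rw [Real.inv_rpow hu0.le, ← Real.rpow_neg hu0.le, ← Real.rpow_natCast u 2,
              ← Real.rpow_mul hu0.le]
            nth_rewrite 1 [← Real.rpow_one u]
            rw [← Real.rpow_add hu0]
            congr 1
            simp only [c]
            push_cast
            ring
          rw [h9, ← Real.mul_rpow (by positivity) hL0.le]
          have : u ^ 2 ≤ c⁻¹ * L := by
            rw [inv_mul_eq_div, le_div_iff₀ hc]
            linarith
          gcongr
        have h10 : q ^ c ≤ E * Real.sqrt R := by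
          calc q ^ c ≤ N⁻¹ ^ c * (Real.exp (3 / 2) * N * (u * h) * (u⁻¹) ^ c) :=
                hqc.trans (by gcongr)
            _ = N⁻¹ ^ c * (Real.exp (3 / 2) * N * h * (u * (u⁻¹) ^ c)) := by ring
            _ ≤ N⁻¹ ^ c * (Real.exp (3 / 2) * N * (A' * Q) * ((c⁻¹) ^ (δ / 2) * L ^ (δ / 2))) := by
                gcongr
            _ = E * (Q * L ^ (δ / 2)) := by simp only [E]; ring
            _ ≤ _ := by gcongr
        refine h10.trans (mul_le_mul_of_nonneg_right ?_ hsR)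
        linarith
      · have h1 : Real.exp (-(c * u ^ 2) / 2) ≤ Real.sqrt D := by
          rw [Real.sqrt_eq_rpow, Real.rpow_def_of_pos hD]
          apply Real.exp_le_exp.2
          have : -Real.log D ≤ L := le_max_right _ _
          linarith
        have h2 : (u⁻¹) ^ c ≤ 1 :=
          Real.rpow_le_one (by positivity) (inv_le_one_of_one_le₀ hu.le) hc.le
        have h3 : q ^ c ≤ N⁻¹ ^ c * Real.sqrt R := by
          refine hqc.trans ?_
          gcongr
          calc _ ≤ Real.sqrt D * 1 := by gcongr
            _ ≤ _ := by rw [mul_one]; exact hDR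
        refine h3.trans (mul_le_mul_of_nonneg_right ?_ hsR)
        linarith
  have hqr : q ≤ B ^ (1 / c) * ratioRate D lam δ := by
    calc q = (q ^ c) ^ (1 / c) := by
          rw [← Real.rpow_mul hq0.le, mul_one_div_cancel hc.ne', Real.rpow_one]
      _ ≤ (B * Real.sqrt R) ^ (1 / c) := by gcongr
      _ = _ := by rw [Real.mul_rpow hB.le hsR]; rfl
  have hr := inv_sqrt_le_ratioRate hδ₀ hδ₁ hD.le hlam0
  have h3 : C₁ / Real.sqrt lam = C₁ * (1 / Real.sqrt lam) := by ring
  rw [h3] at hp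
  have h5 := mul_le_mul_of_nonneg_left hr hC₁
  linarith

end Transfer

/-! ### Uniform convergence of the dropout training loss. -/

/-- The loss patterns of the linear classifiers on a paired sample of documents. -/
lemma exists_finset_zeroOneLoss_sub {d T n : ℕ} (hd : 0 < d) (hdn : d ≤ n)
    (v : Fin n → Example d T × Example d T) :
    ∃ A : Finset (Fin n → ℝ), (A.card : ℝ) ≤ (Real.exp 1 * (2 * n) / d) ^ d ∧
      (∀ a ∈ A, ∀ i, |a i| ≤ 1) ∧ ∀ w : Fin d → ℝ,
        (fun i => zeroOneLoss w (counts (v i).1) (label (v i).1) -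
          zeroOneLoss w (counts (v i).2) (label (v i).2)) ∈ A := by
  classical
  -- Each pair contributes two documents. The loss differences depend on `w` only through which of
  -- these `2n` points lie in its half-space.
  set pts : Fin n × Bool → Fin d → ℝ := fun p j =>
    ((if p.2 then counts (v p.1).1 j else counts (v p.1).2 j : ℕ) : ℝ)
  set 𝒜 : Finset (Finset (Fin n × Bool)) :=
    Finset.univ.filter fun u => ∃ w : Fin d → ℝ, ∀ i, i ∈ u ↔ 0 < ∑ j, w j * pts i j
  set loss : Finset (Fin n × Bool) → Fin n → ℝ := fun u i =>
    (if decide ((i, true) ∈ u) = label (v i).1 then 0 else 1) -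
      (if decide ((i, false) ∈ u) = label (v i).2 then 0 else 1)
  have hcard : Fintype.card (Fin n × Bool) = n * 2 := by simp
  refine ⟨𝒜.image loss, ?_, ?_, ?_⟩
  · have h := card_halfspaces_le hd (by rw [hcard]; omega) pts (𝒜 := 𝒜) fun u hu =>
      (Finset.mem_filter.1 hu).2
    rw [hcard] at h
    push_cast at h
    rw [mul_comm (n : ℝ) 2] at h
    exact le_trans (by exact_mod_cast Finset.card_image_le) h
  · intro a ha i
    obtain ⟨u, _, rfl⟩ := Finset.mem_image.1 ha
    simp only [loss]
    split_ifs <;> norm_num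
  · intro w
    refine Finset.mem_image.2 ⟨Finset.univ.filter fun i => 0 < ∑ j, w j * pts i j, ?_, ?_⟩
    · exact Finset.mem_filter.2 ⟨Finset.mem_univ _, w, fun i => by simp⟩
    · funext i
      simp only [loss, zeroOneLoss, predict, pts, Finset.mem_filter, Finset.mem_univ, true_and,
        if_true, Bool.false_eq_true, if_false]
      congr!

namespace PoissonTopicModel

variable {d T : ℕ} (M : PoissonTopicModel d T)

lemma errDropout_eq (δ : unitInterval) (w : Fin d → ℝ) :
    M.errDropout δ w = (M.thinned δ).err w := by
  rw [errDropout, err, dropoutLaw_eq]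

instance (δ : unitInterval) : IsProbabilityMeasure (M.dropoutLaw δ) := by
  rw [dropoutLaw_eq]; infer_instance

lemma integral_zeroOneLoss_dropoutLaw (δ : unitInterval) (w : Fin d → ℝ) :
    ∫ s, zeroOneLoss w (counts s) (label s) ∂(M.dropoutLaw δ) = M.errDropout δ w := by
  have : (fun s : Example d T => zeroOneLoss w (counts s) (label s)) =
      Set.indicator {z | label z ≠ predict w (counts z)} fun _ => (1 : ℝ) := by
    funext s
    simp only [zeroOneLoss, Set.indicator_apply, Set.mem_ofPred_eq]
    by_cases h : predict w (counts s) = label s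
    · simp [h]
    · rw [if_neg h, if_pos (Ne.symm h)]
  rw [this, integral_indicator_const _ .of_discrete, smul_eq_mul, mul_one]
  rfl

/-- Uniform convergence of the dropout training loss. -/
theorem measure_exists_lt_abs_dropoutTrainLoss_sub_le {n : ℕ} (δ : unitInterval) (hd : 0 < d)
    (hdn : d ≤ n) {t : ℝ} (ht : 0 < t) :
    (Measure.pi fun _ : Fin n => M.law) {z | ∃ w : Fin d → ℝ,
      t < |dropoutTrainLoss δ z w - n * M.errDropout δ w|} ≤
      ENNReal.ofReal (Real.sqrt (8 * n * (d * max 1 (-Real.log ((d : ℝ) / n)))) / t) := by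
  have hn : 0 < n := hd.trans_le hdn
  have hd' : (1 : ℝ) ≤ d := by exact_mod_cast hd
  have hn' : (0 : ℝ) < n := by exact_mod_cast hn
  have hdn' : (d : ℝ) ≤ n := by exact_mod_cast hdn
  set k : Example d T → Measure (Example d T) := fun z =>
    (thin δ (counts z)).map fun x => (label z, topic z, x)
  have : ∀ z, IsProbabilityMeasure (k z) := fun z =>
    Measure.isProbabilityMeasure_map Measurable.of_discrete.aemeasurable
  have hk : M.law.bind k = M.dropoutLaw δ := rfl
  have : IsProbabilityMeasure (M.law.bind k) := by rw [hk]; infer_instance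
  set N : ℝ := (Real.exp 1 * (2 * n) / d) ^ d
  have he : (1 : ℝ) ≤ Real.exp 1 := Real.one_le_exp zero_le_one
  have hbase : 1 ≤ Real.exp 1 * (2 * n) / d := by
    rw [le_div_iff₀ (by linarith)]
    nlinarith
  have hN : 1 ≤ N := one_le_pow₀ hbase
  have h := measure_exists_lt_abs_sum_sub_le (G := fun (w : Fin d → ℝ) (s : Example d T) =>
    zeroOneLoss w (counts s) (label s)) hn hN (fun w s => by
      unfold zeroOneLoss; split_ifs <;> norm_num)
    (exists_finset_zeroOneLoss_sub hd hdn) M.law k ht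
  have e : ∀ (z : Fin n → Example d T) (w : Fin d → ℝ),
      ∑ i, (∫ s, zeroOneLoss w (counts s) (label s) ∂(k (z i)) -
        ∫ s, zeroOneLoss w (counts s) (label s) ∂(M.law.bind k)) =
      dropoutTrainLoss δ z w - n * M.errDropout δ w := by
    intro z w
    rw [hk, integral_zeroOneLoss_dropoutLaw, Finset.sum_sub_distrib, dropoutTrainLoss,
      Finset.sum_const, Finset.card_univ, Fintype.card_fin, nsmul_eq_mul]
    congr 1
    refine Finset.sum_congr rfl fun i _ => ?_
    rw [integral_map Measurable.of_discrete.aemeasurable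
      StronglyMeasurable.of_discrete.aestronglyMeasurable]
  simp only [e] at h
  refine h.trans (ENNReal.ofReal_le_ofReal ?_)
  gcongr ?_ / t
  apply Real.sqrt_le_sqrt
  set L := max 1 (-Real.log ((d : ℝ) / n))
  have hL1 : 1 ≤ L := le_max_left _ _
  have hL2 : -Real.log ((d : ℝ) / n) ≤ L := le_max_right _ _
  -- Since `log 2 < 0.7` and `1 ≤ d L`, the two parts of the logarithm are at most `0.7 d L` and
  -- `2.7 d L`.
  have hlog : Real.log (2 * N) ≤ 4 * (d * L) := by
    have h1 : Real.log (2 * N) =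
        Real.log 2 + d * (1 + Real.log 2 + -Real.log ((d : ℝ) / n)) := by
      rw [Real.log_mul two_ne_zero (by positivity), Real.log_pow,
        show Real.exp 1 * (2 * n) / d = Real.exp 1 * 2 * ((d : ℝ) / n)⁻¹ by
          rw [inv_div]; ring,
        Real.log_mul (by positivity) (by positivity), Real.log_mul (by positivity) two_ne_zero,
        Real.log_exp, Real.log_inv]
    have h2 : Real.log 2 < 0.7 := Real.log_two_lt_d9.trans (by norm_num)
    have h3 : (1 : ℝ) ≤ d * L := by nlinarith
    have h4 : d * (1 + Real.log 2 + -Real.log ((d : ℝ) / n)) ≤ d * (1.7 * L + L) := by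
      gcongr
      linarith
    rw [h1]
    linarith
  calc 2 * n * Real.log (2 * N) ≤ 2 * n * (4 * (d * L)) := by gcongr
    _ = _ := by ring

/-! ### Miss probabilities topic by topic. -/

lemma minLength_le (τ : Fin T) : M.minLength ≤ M.meanLength τ :=
  ciInf_le (Set.finite_range _).bddBelow τ

lemma dim_pos (h : 0 < M.minLength) : 0 < d := by
  rcases Nat.eq_zero_or_pos d with rfl | hd
  · have : M.minLength = 0 := by
      simp only [minLength, meanLength, Finset.univ_eq_empty, Finset.sum_empty]
      -- The real infimum of the constant `0` is `0` even when there are no topics.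
      exact Real.iInf_const_zero
    exact absurd h (by rw [this]; exact lt_irrefl _)
  · exact hd

lemma WellBalanced.sq_mul_le {κ : ℝ} {w : Fin d → ℝ} (hw : M.WellBalanced κ w) (τ : Fin T)
    (j : Fin d) :
    w j ^ 2 * ∑ i, (M.rate τ i : ℝ) ≤ κ * ∑ i, (M.rate τ i : ℝ) * w i ^ 2 := by
  obtain ⟨hv, hb⟩ := hw τ
  rw [div_le_iff₀ hv] at hb
  refine le_trans ?_ hb
  have h1 : w j ^ 2 ≤ ⨆ j, w j ^ 2 :=
    le_ciSup (f := fun j => w j ^ 2) (Set.finite_range _).bddAbove j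
  exact mul_le_mul_of_nonneg_right h1 (Finset.sum_nonneg fun i _ => NNReal.coe_nonneg _)

/-- The standardised margin of the linear classifier on a topic. -/
noncomputable def margin (w : Fin d → ℝ) (τ : Fin T) : ℝ :=
  boolSign (M.bestLabel τ) * zScore (M.rate τ) w

lemma bestLabel_thinned (δ : unitInterval) (τ : Fin T) :
    (M.thinned δ).bestLabel τ = M.bestLabel τ := by
  simp only [bestLabel, labelProb_eq, topicProb_eq]
  rfl

lemma errMin_thinned (δ : unitInterval) : (M.thinned δ).errMin = M.errMin := by
  simp only [errMin_eq, bestLabel_thinned]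
  rfl

lemma abs_missProb_sub_le {κ : ℝ} {w : Fin d → ℝ} (hκ : 0 < κ) (hw : M.WellBalanced κ w)
    (hlam : 0 < M.minLength) (τ : Fin T) :
    |M.missProb w τ - gaussInt (-M.margin w τ) / gaussTotal| ≤
      (10 + millsConst) * Real.sqrt κ / Real.sqrt M.minLength := by
  have hr : 0 < ∑ j, (M.rate τ j : ℝ) := hlam.trans_le (M.minLength_le τ)
  refine (abs_measureReal_predict_ne_sub_le (hw τ).1 hr (hw.sq_mul_le M τ) _).trans ?_
  have := millsConst_pos
  rw [mul_div_assoc, ← Real.sqrt_div hκ.le]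
  gcongr
  exact M.minLength_le τ

/-- The balance ratio is unchanged when all rates are scaled, so the same `κ` works; only the mean
length shrinks, which costs `1/√(1-δ)`. -/
lemma abs_missProb_thinned_sub_le {κ : ℝ} {w : Fin d → ℝ} (hκ : 0 < κ)
    (hw : M.WellBalanced κ w) (hlam : 0 < M.minLength) {δ : unitInterval} (hδ : δ < 1)
    (τ : Fin T) :
    |(M.thinned δ).missProb w τ -
      gaussInt (-(Real.sqrt (1 - δ) * M.margin w τ)) / gaussTotal| ≤
      (10 + millsConst) * Real.sqrt κ / Real.sqrt (1 - δ) / Real.sqrt M.minLength := by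
  have hδ' : (0 : ℝ) < 1 - δ := sub_pos.2 (by exact_mod_cast hδ)
  set c : ℝ≥0 := unitInterval.toNNReal (unitInterval.symm δ)
  have hc : (c : ℝ) = 1 - δ := by simp [c]
  have hrate : (M.thinned δ).rate τ = fun j => c * M.rate τ j := rfl
  have hr : 0 < ∑ j, (M.rate τ j : ℝ) := hlam.trans_le (M.minLength_le τ)
  have h1 : ∑ j, (((M.thinned δ).rate τ j : ℝ≥0) : ℝ) = (1 - δ) * ∑ j, (M.rate τ j : ℝ) := by
    rw [hrate, Finset.mul_sum]
    exact Finset.sum_congr rfl fun j _ => by push_cast; rw [hc]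
  have h2 : ∑ j, (((M.thinned δ).rate τ j : ℝ≥0) : ℝ) * w j ^ 2 =
      (1 - δ) * ∑ j, (M.rate τ j : ℝ) * w j ^ 2 := by
    rw [hrate, Finset.mul_sum]
    exact Finset.sum_congr rfl fun j _ => by push_cast; rw [hc]; ring
  have h := abs_measureReal_predict_ne_sub_le (r := (M.thinned δ).rate τ) (w := w) (κ := κ)
    (by rw [h2]; exact mul_pos hδ' (hw τ).1) (by rw [h1]; exact mul_pos hδ' hr)
    (fun j => by
      rw [h1, h2]
      have := mul_le_mul_of_nonneg_left (hw.sq_mul_le M τ j) hδ'.le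
      linarith) ((M.thinned δ).bestLabel τ)
  rw [h1] at h
  have hm : boolSign ((M.thinned δ).bestLabel τ) * zScore ((M.thinned δ).rate τ) w =
      Real.sqrt (1 - δ) * M.margin w τ := by
    rw [hrate, zScore_mul, hc, bestLabel_thinned, margin]
    ring
  rw [hm] at h
  refine h.trans ?_
  have := millsConst_pos
  rw [div_div, ← Real.sqrt_mul hδ'.le, mul_div_assoc, ← Real.sqrt_div hκ.le]
  gcongr
  exact M.minLength_le τ

/-- All terms of the excess risk are nonnegative, so each single topic is bounded by the whole. -/
lemma le_errDropout_sub_errMin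
    {pmin α : ℝ} (hpmin : 0 < pmin) (hα : 0 < α)
    (hp : ∀ τ, pmin ≤ M.topicProb τ) (hl : ∀ c τ, α ≤ |M.labelProb c τ - 1 / 2|)
    (δ : unitInterval) (w : Fin d → ℝ) (τ : Fin T) :
    2 * α * pmin * (M.thinned δ).missProb w τ ≤ M.errDropout δ w - M.errMin := by
  rw [errDropout_eq, ← M.errMin_thinned δ, err_sub_errMin]
  have hmar : ∀ σ, 2 * α * pmin ≤ (M.thinned δ).jointProb ((M.thinned δ).bestLabel σ) σ -
      (M.thinned δ).jointProb (!(M.thinned δ).bestLabel σ) σ := by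
    intro σ
    rw [bestLabel_thinned]
    refine le_trans ?_ (M.bestLabel_margin (hpmin.trans_le (hp σ)) fun c => hl c σ)
    exact mul_le_mul_of_nonneg_left (hp σ) (by positivity)
  have h0 : 0 ≤ 2 * α * pmin := by positivity
  refine (mul_le_mul_of_nonneg_right (hmar τ) ((M.thinned δ).missProb_nonneg w τ)).trans ?_
  exact Finset.single_le_sum (f := fun σ =>
    ((M.thinned δ).jointProb ((M.thinned δ).bestLabel σ) σ -
      (M.thinned δ).jointProb (!(M.thinned δ).bestLabel σ) σ) * (M.thinned δ).missProb w σ)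
    (fun σ _ => mul_nonneg (h0.trans (hmar σ)) ((M.thinned δ).missProb_nonneg w σ))
    (Finset.mem_univ τ)

/-- The weights on the miss probabilities are nonnegative and bounded by topic probabilities, which
sum to one. -/
lemma err_sub_errMin_mem
    {pmin α : ℝ} (hpmin : 0 < pmin) (hα : 0 < α)
    (hp : ∀ τ, pmin ≤ M.topicProb τ) (hl : ∀ c τ, α ≤ |M.labelProb c τ - 1 / 2|)
    {w : Fin d → ℝ} {X : ℝ} (hX : ∀ τ, M.missProb w τ ≤ X) :
    0 ≤ M.err w - M.errMin ∧ M.err w - M.errMin ≤ X := by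
  rw [err_sub_errMin]
  have hmar : ∀ σ, 0 ≤ M.jointProb (M.bestLabel σ) σ - M.jointProb (!M.bestLabel σ) σ := fun σ =>
    le_trans (mul_nonneg (by positivity) (hpmin.le.trans (hp σ)))
      (M.bestLabel_margin (hpmin.trans_le (hp σ)) fun c => hl c σ)
  refine ⟨Finset.sum_nonneg fun σ _ => mul_nonneg (hmar σ) (M.missProb_nonneg w σ), ?_⟩
  calc _ ≤ ∑ σ, M.topicProb σ * X := Finset.sum_le_sum fun σ _ =>
        mul_le_mul (M.jointProb_sub_le σ) (hX σ) (M.missProb_nonneg w σ)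
          (hpmin.le.trans (hp σ))
    _ = X := by rw [← Finset.sum_mul, sum_topicProb, one_mul]

end PoissonTopicModel

lemma excessRate_eq (d n : ℕ) (lam δ : ℝ) :
    excessRate d n lam δ = ratioRate ((d : ℝ) / n) lam δ := by
  rw [excessRate, ratioRate, ← Real.log_inv, inv_div]

namespace PoissonTopicModel

variable {d T : ℕ} (M : PoissonTopicModel d T)

lemma abs_err_sub_le_one (w w' : Fin d → ℝ) : |M.err w - M.err w'| ≤ 1 := by
  have h1 : 0 ≤ M.err w := measureReal_nonneg
  have h2 : 0 ≤ M.err w' := measureReal_nonneg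
  have h3 : M.err w ≤ 1 := measureReal_le_one
  have h4 : M.err w' ≤ 1 := measureReal_le_one
  rw [abs_le]
  constructor <;> linarith

/-- A training sample with small uniform deviation gives a dropout minimiser of small dropout
risk. -/
lemma errDropout_sub_le_of_isDropoutERM {n : ℕ} (hn : 0 < n) {κ : ℝ} {δ : unitInterval}
    {z : Fin n → Example d T} {w wStar : Fin d → ℝ} {t : ℝ} (hw : M.IsDropoutERM κ δ z w)
    (hStar : M.WellBalanced κ wStar)
    (hdev : ∀ v : Fin d → ℝ, |dropoutTrainLoss δ z v - n * M.errDropout δ v| ≤ t) :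
    M.errDropout δ w - M.errDropout δ wStar ≤ 2 * t / n := by
  have hn' : (0 : ℝ) < n := by exact_mod_cast hn
  have h1 := abs_le.1 (hdev w)
  have h2 := abs_le.1 (hdev wStar)
  have h3 := hw.2 wStar hStar
  rw [le_div_iff₀ hn']
  linarith

end PoissonTopicModel

/-! ### Assembly of the excess risk bound. -/

/-- The excess risk bound for a well-balanced classifier with small excess dropout risk. -/
lemma exists_forall_missProb_le {δ : unitInterval} (hδ₀ : 0 < δ) (hδ₁ : δ < 1) {κ : ℝ}
    (hκ : 0 < κ) {pmin : ℝ} (hpmin : 0 < pmin) {α : ℝ} (hα : 0 < α) {A : ℝ} (hA : 0 ≤ A) :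
    ∃ C : ℝ, 0 < C ∧ ∀ (d T : ℕ) (M : PoissonTopicModel d T) (D : ℝ), 0 < D →
      1 ≤ M.minLength → (∀ τ, pmin ≤ M.topicProb τ) →
      (∀ c τ, α ≤ |M.labelProb c τ - 1 / 2|) → ∀ w : Fin d → ℝ, M.WellBalanced κ w →
      M.errDropout δ w - M.errMin ≤
        A * (Real.sqrt (D * max 1 (-Real.log D)) + 1 / Real.sqrt M.minLength) →
      ∀ τ, M.missProb w τ ≤ C * ratioRate D M.minLength δ := by
  have hδ₀' : (0 : ℝ) < δ := by exact_mod_cast hδ₀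
  have hδ₁' : (δ : ℝ) < 1 := by exact_mod_cast hδ₁
  have hs0 : 0 < Real.sqrt (1 - δ) := Real.sqrt_pos.2 (by linarith)
  have hs1 : Real.sqrt (1 - δ) ≤ 1 := Real.sqrt_le_one.2 (by linarith)
  have hm := millsConst_pos
  set C₁ := (10 + millsConst) * Real.sqrt κ / Real.sqrt (1 - δ)
  have hC₁ : 0 ≤ C₁ := by positivity
  have hC₁' : (10 + millsConst) * Real.sqrt κ ≤ C₁ := by
    rw [le_div_iff₀ hs0]
    exact mul_le_of_le_one_right (by positivity) hs1
  obtain ⟨C, hC, h⟩ := exists_tail_transfer hδ₀' hδ₁' hC₁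
    (A := A / (2 * α * pmin)) (by positivity)
  refine ⟨C, hC, fun d T M D hD hlam hp hl w hw hexc τ => ?_⟩
  have hlam0 : 0 < M.minLength := by linarith
  have hB := abs_le.1 (M.abs_missProb_sub_le hκ hw hlam0 τ)
  have hB' := abs_le.1 (M.abs_missProb_thinned_sub_le hκ hw hlam0 hδ₁ τ)
  have hC₁'' : (10 + millsConst) * Real.sqrt κ / Real.sqrt M.minLength ≤
      C₁ / Real.sqrt M.minLength := by gcongr
  refine h (M.margin w τ) (M.missProb w τ) ((M.thinned δ).missProb w τ) D M.minLength hD hlam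
    (by linarith) (by linarith) ?_
  have h1 := (M.le_errDropout_sub_errMin hpmin hα hp hl δ w τ).trans hexc
  rw [div_mul_eq_mul_div, le_div_iff₀ (by positivity)]
  linarith

end DropoutTopic

theorem corollary1 (δ : unitInterval) (hδ₀ : 0 < δ) (hδ₁ : δ < 1)
    (κ : ℝ) (hκ : 0 < κ) (pmin : ℝ) (hpmin : 0 < pmin) (α : ℝ) (hα : 0 < α)
    (K : ℝ) (ε : ℝ) (hε : 0 < ε) :
    ∃ C : ℝ, 0 < C ∧
      ∀ (d T n : ℕ) (M : DropoutTopic.PoissonTopicModel d T),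
        0 < n → 0 < M.minLength →
        -- the topics are neither too rare nor too ambiguous
        (∀ τ, pmin ≤ M.topicProb τ) →
        (∀ c τ, α ≤ |M.labelProb c τ - 1 / 2|) →
        -- the best well-balanced linear rule, and the distinct topics assumption
        ∀ wStar : Fin d → ℝ, M.IsDropoutMinimizer κ δ wStar →
        |M.errDropout δ wStar - M.errMin| ≤ K / Real.sqrt M.minLength →
        -- an i.i.d. training sample and the classifier trained on it with dropout
        ∀ (Ω : Type*) [MeasurableSpace Ω] (P : Measure Ω) [IsProbabilityMeasure P]
          (Z : Fin n → Ω → DropoutTopic.Example d T),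
          iIndepFun Z P → (∀ i, HasLaw (Z i) M.law P) →
        ∀ wHat : Ω → Fin d → ℝ,
          (∀ᵐ ω ∂P, M.IsDropoutERM κ δ (fun i => Z i ω) (wHat ω)) →
          P {ω | C * DropoutTopic.excessRate d n M.minLength (δ : ℝ) <
              |M.err (wHat ω) - M.err wStar|} ≤ ENNReal.ofReal ε := by
  have hδ₀' : (0 : ℝ) < δ := by exact_mod_cast hδ₀
  have hδ₁' : (δ : ℝ) < 1 := by exact_mod_cast hδ₁
  -- The first summand is the coefficient of `√(D L)` in `2t/n`, the estimation error of the
  -- minimiser; `|K|` comes from the excess of `wStar` over `errMin`.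
  set A : ℝ := 2 * Real.sqrt 8 / ε + |K|
  have hA : 0 ≤ A := by positivity
  obtain ⟨C, hC, hmiss⟩ :=
    DropoutTopic.exists_forall_missProb_le hδ₀ hδ₁ hκ hpmin hα hA
  refine ⟨max 1 C, lt_max_of_lt_left one_pos, ?_⟩
  intro d T n M hn hlam hp hl wStar hStar hK Ω _ P _ Z hind hlaw wHat hERM
  rw [DropoutTopic.excessRate_eq]
  have hn' : (0 : ℝ) < n := by exact_mod_cast hn
  have hd := M.dim_pos hlam
  have hd' : (0 : ℝ) < d := by exact_mod_cast hd
  set D : ℝ := (d : ℝ) / n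
  have hD : 0 < D := by positivity
  -- When `d ≥ n` or `λ ≤ 1` the rate is at least `1`, and error rates differ by at most `1`.
  by_cases htriv : 1 ≤ D ∨ M.minLength ≤ 1
  · have h1 := DropoutTopic.one_le_ratioRate hδ₀' hδ₁' hD.le hlam htriv
    have hempty : {ω | max 1 C * DropoutTopic.ratioRate D M.minLength δ <
        |M.err (wHat ω) - M.err wStar|} = ∅ := by
      ext ω
      simp only [Set.mem_ofPred_eq, Set.mem_empty_iff_false, iff_false, not_lt]
      refine (M.abs_err_sub_le_one _ _).trans ?_
      have := le_max_left 1 C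
      nlinarith
    rw [hempty]
    simp
  push Not at htriv
  obtain ⟨hD1, hlam1⟩ := htriv
  have hdn : d ≤ n := by
    rw [div_lt_one hn'] at hD1
    exact_mod_cast hD1.le
  set L := max 1 (-Real.log D)
  have hL : 0 < L := lt_max_of_lt_left one_pos
  set S := Real.sqrt (8 * n * (d * L))
  have hS : 0 < S := Real.sqrt_pos.2 (by positivity)
  -- With this threshold the Markov bound `S / t` is exactly `ε`.
  set t := S / ε
  have ht : 0 < t := by positivity
  have hunif := M.measure_exists_lt_abs_dropoutTrainLoss_sub_le δ hd hdn ht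
  have hSt : S / t = ε := by
    simp only [t]
    field_simp
  rw [hSt] at hunif
  have htn : 2 * t / n = 2 * Real.sqrt 8 / ε * Real.sqrt (D * L) := by
    have : S = Real.sqrt 8 * n * Real.sqrt (D * L) := by
      simp only [S]
      rw [show 8 * (n : ℝ) * (d * L) = 8 * (n ^ 2 * (D * L)) by simp only [D]; field_simp,
        Real.sqrt_mul (by norm_num), Real.sqrt_mul (by positivity), Real.sqrt_sq hn'.le,
        mul_assoc]
    simp only [t]
    rw [this]
    field_simp
  have hKlam : K / Real.sqrt M.minLength ≤ |K| * (1 / Real.sqrt M.minLength) := by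
    rw [mul_one_div]
    gcongr
    exact le_abs_self K
  have hstarExc : M.errDropout δ wStar - M.errMin ≤ |K| * (1 / Real.sqrt M.minLength) :=
    (le_abs_self _).trans (hK.trans hKlam)
  set X := C * DropoutTopic.ratioRate D M.minLength δ
  have hlamS : 0 ≤ 1 / Real.sqrt M.minLength := by positivity
  have hDL : 0 ≤ Real.sqrt (D * L) := Real.sqrt_nonneg _
  have hε8 : 0 ≤ 2 * Real.sqrt 8 / ε := by positivity
  have hmissStar := hmiss d T M D hD hlam1.le hp hl wStar hStar.1 (by
    have h1 : 0 ≤ A * Real.sqrt (D * L) := by positivity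
    have h2 : |K| * (1 / Real.sqrt M.minLength) ≤ A * (1 / Real.sqrt M.minLength) := by
      gcongr
      exact le_add_of_nonneg_left hε8
    linarith)
  have hStarB := M.err_sub_errMin_mem hpmin hα hp hl hmissStar
  -- The bad event quantifies over all weights and depends on the sample alone, so no measurable
  -- choice of `wHat` is needed.
  set bad : Set (Fin n → DropoutTopic.Example d T) := {z | ∃ w : Fin d → ℝ,
    t < |DropoutTopic.PoissonTopicModel.dropoutTrainLoss δ z w - n * M.errDropout δ w|}
  have hZ : ∀ i, AEMeasurable (Z i) P := fun i => (hlaw i).aemeasurable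
  have hmap : P.map (fun ω i => Z i ω) = Measure.pi fun _ : Fin n => M.law := by
    rw [hind.map_fun_eq_pi_map hZ]
    congr 1
    funext i
    exact (hlaw i).map_eq
  have hbad : P ((fun ω i => Z i ω) ⁻¹' bad) ≤ ENNReal.ofReal ε := by
    rw [← Measure.map_apply_of_aemeasurable (aemeasurable_pi_lambda _ hZ) .of_discrete, hmap]
    exact hunif
  refine (measure_mono_ae ?_).trans hbad
  filter_upwards [hERM] with ω hω hlt
  by_contra hgood
  simp only [bad, Set.preimage_ofPred_eq] at hgood
  have hdev : ∀ w : Fin d → ℝ, |DropoutTopic.PoissonTopicModel.dropoutTrainLoss δ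
      (fun i => Z i ω) w - n * M.errDropout δ w| ≤ t := fun w =>
    not_lt.1 fun h => hgood ⟨w, h⟩
  have hexc := M.errDropout_sub_le_of_isDropoutERM hn hω hStar.1 hdev
  rw [htn] at hexc
  have hmissHat := hmiss d T M D hD hlam1.le hp hl (wHat ω) hω.1 (by
    have h1 : 2 * Real.sqrt 8 / ε * Real.sqrt (D * L) ≤ A * Real.sqrt (D * L) := by
      gcongr
      exact le_add_of_nonneg_right (abs_nonneg K)
    have h2 : |K| * (1 / Real.sqrt M.minLength) ≤ A * (1 / Real.sqrt M.minLength) := by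
      gcongr
      exact le_add_of_nonneg_left hε8
    linarith)
  have hHatB := M.err_sub_errMin_mem hpmin hα hp hl hmissHat
  -- Both risks lie in `[errMin, errMin + X]`.
  have hfin : |M.err (wHat ω) - M.err wStar| ≤ X := by
    rw [abs_le]
    constructor <;> linarith [hHatB.1, hHatB.2, hStarB.1, hStarB.2]
  have hrate : 0 ≤ DropoutTopic.ratioRate D M.minLength δ :=
    Real.rpow_nonneg (Real.sqrt_nonneg _) _
  have hle : X ≤ max 1 C * DropoutTopic.ratioRate D M.minLength δ :=
    mul_le_mul_of_nonneg_right (le_max_right _ _) hrate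
  exact absurd (show max 1 C * DropoutTopic.ratioRate D M.minLength δ <
    |M.err (wHat ω) - M.err wStar| from hlt) (not_lt.2 (hfin.trans hle))
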